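/- A Streett automaton with costs is a tuple $\mathcal A=(Q,\Sigma,q_I,\delta,(Q_j,P_j)_{j\in J},(\mathrm{Cst}_j)_{j\in J})$ with a finite set $Q$ of states, an alphabet $\Sigma$, an initial state $q_I\in Q$, a transition function $\delta\colon Q\times\Sigma\to Q$, a finite family of Streett pairs $Q_j,P_j\subseteq Q$ and, for each $j\in J$, a cost function $\mathrm{Cst}_j$ labelling every transition by $\epsilon$ or $\mathtt i$; the cost $\mathrm{Cst}_j$ of a finite run is the number of its $\mathtt i$-labelled transitions. For the run $\rho=(q_0,a_0,q_1)(q_1,a_1,q_2)\cdots$ of $\mathcal A$ on an infinite word $a_0a_1\cdots$ (so $q_0=q_I$ and $q_{m+1}=\delta(q_m,a_m)$), put $\mathrm{StCor}_j(\rho,m)=0$ if $q_m\notin Q_j$, and otherwise $$\mathrm{StCor}_j(\rho,m)=\min\{\mathrm{Cst}_j((q_m,a_m,q_{m+1})\cdots(q_{m'-1},a_{m'-1},q_{m'})) \mid m'\ge m,\ q_{m'}\in P_j\},\qquad \min\emptyset=\infty .$$ Let $\mathrm{StCor}(\rho,m)=\max_{j\in J}\mathrm{StCor}_j(\rho,m)$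 (which is $0$ if $J=\emptyset$). The language $L(\mathcal A)$ is the set of infinite words whose run satisfies $\limsup_{m\to\infty}\mathrm{StCor}(\rho,m)<\infty$. A delay function is a map $f\colon\mathbb N\to\mathbb N\setminus\{0\}$; it is constant if $f(i)=1$ for all $i>0$. In the delay game $\Gamma_f(L)$ with $L\subseteq(\Sigma_I\times\Sigma_O)^\omega$, in each round $i=0,1,2,\dots$ Player $I$ picks a word $u_i\in\Sigma_I^{f(i)}$ and then Player $O$ picks a letter $v_i\in\Sigma_O$. Player $O$ wins the play if the outcome $\binom{u_0u_1u_2\cdots}{v_0v_1v_2\cdots}$ is in $L$; otherwise Player $I$ wins it. A strategy for Player $I$ is a map $\tau_I\colon\Sigma_O^*\to\Sigma_I^*$ with $|\tau_I(w)|=f(|w|)$, and a play is consistent with it if $u_i=\tau_I(v_0\cdots v_{i-1})$ for all $i$; a strategy for Player $O$ is a map $\tau_O\colon\Sigma_I^*\to\Sigma_O$, and a play is consistent with it if $v_i=\tau_O(u_0\cdots u_i)$ for all $i$. A player wins $\Gamma_f(L)$ if he or she has a strategy all of whose consistent plays are won by that player. **Theorem.** Let $L=L(\mathcal A)$ for a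 Streett automaton with costs $\mathcal A$ over $\Sigma_I\times\Sigma_O$ with $n$ states and $k$ Streett pairs, and let $f$ be the constant delay function with $f(0)=2^{n^4 2^{3k}+1}$. Then the following are equivalent: 1. Player $I$ wins $\Gamma_f(L)$. 2. Player $I$ wins $\Gamma_{f'}(L)$ for every delay function $f'$. In particular, doubly-exponential constant lookahead suffices for Player $O$: if Player $O$ wins $\Gamma_{f'}(L)$ for some delay function $f'$, then she wins $\Gamma_f(L)$. -/

import Mathlib

/-- The two kinds of transitions: `eps` (the transition is free) and `inc` (the transition costs one
unit). -/
inductive TransitionCost : Type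
  | eps : TransitionCost
  | inc : TransitionCost
  deriving DecidableEq

/-- A (deterministic, complete) Streett automaton with costs over the alphabet `A`, with state set
`Q` and with Streett pairs indexed by `J`. As `δ` is a function, a transition `(q, a, q')` is
determined by `(q, a)`, so the cost functions are maps on `Q × A`, one for each Streett pair.
Finiteness of `Q` and `J` is imposed where the automaton is used. -/
structure StreettAutomaton (Q A J : Type*) where
  /-- the initial state -/
  init : Q
  /-- the transition function -/
  δ : Q → A → Q
  /-- the set `Q_j` of requests of condition `j` -/
  request : J → Set Q
  /-- the set `P_j` of responses of condition `j` -/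
  response : J → Set Q
  /-- the cost function of condition `j` -/
  cst : J → Q → A → TransitionCost

namespace StreettAutomaton

variable {Q A J : Type*}

/-- `𝒜.state w m` is the state `q_m` of the run `(q₀, w 0, q₁) (q₁, w 1, q₂) ⋯` of `𝒜` on the
infinite word `w`, which starts in the initial state. -/
def state (𝒜 : StreettAutomaton Q A J) (w : ℕ → A) : ℕ → Q
  | 0 => 𝒜.init
  | m + 1 => 𝒜.δ (𝒜.state w m) (w m)

/-- The cost with respect to condition `j` of the infix
`(q_m, w m, q_{m+1}) ⋯ (q_{m'-1}, w (m'-1), q_{m'})` of the run on `w`: the number of its increment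
transitions. -/
def infixCost (𝒜 : StreettAutomaton Q A J) (j : J) (w : ℕ → A) (m m' : ℕ) : ℕ :=
  ((Finset.Ico m m').filter fun i => 𝒜.cst j (𝒜.state w i) (w i) = TransitionCost.inc).card

open Classical in
/-- The cost-of-response of pair `j` at position `m`; the infimum is `⊤` if the request is never
answered, and is a minimum otherwise. -/
noncomputable def stCorPair (𝒜 : StreettAutomaton Q A J) (j : J) (w : ℕ → A) (m : ℕ) : ℕ∞ :=
  if 𝒜.state w m ∈ 𝒜.request j then
    ⨅ m' ∈ {m' : ℕ | m ≤ m' ∧ 𝒜.state w m' ∈ 𝒜.response j}, (𝒜.infixCost j w m m' : ℕ∞)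
  else 0

/-- The aggregated cost-of-response at position `m`, the maximum over all pairs. -/
noncomputable def stCor (𝒜 : StreettAutomaton Q A J) (w : ℕ → A) (m : ℕ) : ℕ∞ :=
  ⨆ j : J, 𝒜.stCorPair j w m

/-- The language of `𝒜`: all infinite words whose run satisfies the Streett condition with costs. -/
def language (𝒜 : StreettAutomaton Q A J) : Set (ℕ → A) :=
  {w | Filter.limsup (𝒜.stCor w) Filter.atTop < ⊤}

end StreettAutomaton

/-- Delay functions `f : ℕ → ℕ \ {0}`. -/
abbrev DelayFunction : Type := ℕ → ℕ+

namespace DelayFunction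

/-- A delay function is constant if `f i = 1` for every `i > 0`. -/
def IsConstant (f : DelayFunction) : Prop :=
  ∀ i, 0 < i → f i = 1

end DelayFunction

namespace DelayGame

variable {X Y : Type*}

/-- A play `(u₀, v₀) (u₁, v₁) ⋯` of a delay game with delay function `f`, where Player I has the
alphabet `X` and Player O has the alphabet `Y`: in round `i`, Player I picks a word `u i` of length
`f i`, then Player O picks a letter `v i`. -/
structure Play (X Y : Type*) (f : DelayFunction) where
  u : ℕ → List X
  length_u : ∀ i, (u i).length = f i
  v : ℕ → Y

namespace Play

variable {f : DelayFunction}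

/-- The finite word `u₀ u₁ ⋯ u_{i-1}`. -/
def inputPrefix (P : Play X Y f) (i : ℕ) : List X :=
  (List.range i).flatMap P.u

/-- The finite word `v₀ v₁ ⋯ v_{i-1}`. -/
def outputPrefix (P : Play X Y f) (i : ℕ) : List Y :=
  (List.range i).map P.v

theorem le_length_inputPrefix (P : Play X Y f) (i : ℕ) : i ≤ (P.inputPrefix i).length := by
  induction i with
  | zero => exact Nat.zero_le _
  | succ i ih =>
    have h1 : P.inputPrefix (i + 1) = P.inputPrefix i ++ P.u i := by
      simp [inputPrefix, List.range_succ, List.flatMap_append]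
    have h2 : 0 < (P.u i).length := by
      rw [P.length_u i]
      exact (f i).pos
    rw [h1, List.length_append]
    omega

/-- The infinite word `u₀ u₁ u₂ ⋯`: as all `u i` are non-empty, its letter at position `m` is the
letter at position `m` of `u₀ ⋯ u_m`. -/
def input (P : Play X Y f) (m : ℕ) : X :=
  (P.inputPrefix (m + 1))[m]'(P.le_length_inputPrefix (m + 1))

/-- The outcome of a play: the word over `X × Y` whose components are `u₀ u₁ u₂ ⋯` and
`v₀ v₁ v₂ ⋯`. -/
def outcome (P : Play X Y f) (m : ℕ) : X × Y :=
  (P.input m, P.v m)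

end Play

/-- A strategy for Player I: a map `τ` from words over `Y` to words over `X` with
`|τ w| = f |w|`. -/
structure StrategyI (X Y : Type*) (f : DelayFunction) where
  move : List Y → List X
  length_move : ∀ w, (move w).length = f w.length

/-- A strategy for Player O: a map from words over `X` to `Y`. -/
abbrev StrategyO (X Y : Type*) : Type _ := List X → Y

/-- A play is consistent with `τ` if `u_i = τ (v₀ ⋯ v_{i-1})` for every `i`. -/
def StrategyI.Consistent {f : DelayFunction} (τ : StrategyI X Y f) (P : Play X Y f) : Prop :=
  ∀ i, P.u i = τ.move (P.outputPrefix i)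

/-- A play is consistent with `τ` if `v_i = τ (u₀ ⋯ u_i)` for every `i`. -/
def StrategyO.Consistent {f : DelayFunction} (τ : StrategyO X Y) (P : Play X Y f) : Prop :=
  ∀ i, P.v i = τ (P.inputPrefix (i + 1))

/-- Player I wins the delay game with delay function `f` and winning condition `L`. -/
def PlayerIWins (f : DelayFunction) (L : Set (ℕ → X × Y)) : Prop :=
  ∃ τ : StrategyI X Y f, ∀ P : Play X Y f, τ.Consistent P → P.outcome ∉ L

/-- Player O wins the delay game with delay function `f` and winning condition `L`. -/
def PlayerOWins (f : DelayFunction) (L : Set (ℕ → X × Y)) : Prop :=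
  ∃ τ : StrategyO X Y, ∀ P : Play X Y f, StrategyO.Consistent τ P → P.outcome ∈ L

end DelayGame

/-! Cut the input into blocks. All that matters of an input block `x` is the relation `reach x`:
from each state, which end states can be reached under some choice of output letters, and with which
summary for each pair (a response, an open request, an increment). There are at most `2 ^ (n ^ 2 * 2
^ (3 * k))` such relations. By pumping, a word at least that long shares its relation with
arbitrarily long words (`exists_long_of_le_length`).

This gives a delay-free game on a finite arena: Player I announces the class of the block after the
next one, then Player O picks a run on the next block. If Player O wins it for every initial class,
she wins the delay game with a lookahead of two blocks (`playerOWins_of_oWinsCost`). If Player I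
wins it for some initial class, he realizes the classes by words long enough to absorb any given
delay (`playerIWins_of_iWinsCost`). Costs are counted as the number of blocks with an increment.
This never overestimates the true cost (`good_of_mem_language`). For blocks of bounded length it is
also right up to a constant factor (`mem_language_of_good`), and only Player O needs that direction.

It remains to see that the class game is determined (`CostGame.determinacy`). For a fixed cost bound
`b`, counters turn it into a finite Streett game, where either Player O wins or her opponent wins
positionally (`StreettGame.determinacy`). If Player O does not win the cost game, she loses for
every `b`. Player I then plays for one bound and passes to a larger one whenever it is exceeded.
Either the bounds grow forever and the costs are unbounded, or he finally wins for a fixed bound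
through unanswered requests. -/

namespace StreettGame

/-! ### Determinacy of finite Streett games, with positional strategies for the opponent. -/

open Filter

variable {V A B ι : Type*}

/-- The history `[α (t-1), …, α 0]` of the first `t` letters of `α`, most recent letter first. -/
def hist (α : ℕ → A) : ℕ → List A
  | 0 => []
  | t + 1 => α t :: hist α t

theorem hist_congr {α α' : ℕ → A} {t : ℕ} (h : ∀ s < t, α s = α' s) : hist α t = hist α' t := by
  induction t with
  | zero => rfl
  | succ t ih =>
    simp only [hist]
    rw [h t (Nat.lt_succ_self t), ih fun s hs => h s (Nat.lt_succ_of_lt hs)]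

/-- The Streett condition on a sequence: every request that occurs infinitely often is accompanied
by infinitely many responses. -/
def Streett {E : Type*} (req resp : ι → E → Prop) (e : ℕ → E) : Prop :=
  ∀ i, (∃ᶠ t in atTop, req i (e t)) → ∃ᶠ t in atTop, resp i (e t)

theorem frequently_atTop_add {p : ℕ → Prop} (N : ℕ) :
    (∃ᶠ t in atTop, p (t + N)) ↔ ∃ᶠ t in atTop, p t := by
  rw [← frequently_map (m := fun t => t + N) (P := p), map_add_atTop_eq_nat]

theorem Streett.shift_iff {E : Type*} {req resp : ι → E → Prop} {e : ℕ → E} (N : ℕ) :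
    Streett req resp (fun t => e (t + N)) ↔ Streett req resp e := by
  unfold Streett
  refine forall_congr' fun i => ?_
  rw [frequently_atTop_add (p := fun t => req i (e t)),
    frequently_atTop_add (p := fun t => resp i (e t))]

/-- The second player, who answers each move in `A` by a move in `B`, wins from `v` against all
opponents that move within `al`. -/
def OWins (nxt : V → A → B → V) (req resp : ι → V × A × B → Prop) (al : V → Set A) (v : V) : Prop :=
  ∃ σ : List A → B, ∀ (x : ℕ → V) (α : ℕ → A), x 0 = v → (∀ t, α t ∈ al (x t)) →
    (∀ t, x (t + 1) = nxt (x t) (α t) (σ (hist α (t + 1)))) →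
      Streett req resp fun t => (x t, α t, σ (hist α (t + 1)))

/-- The positional strategy `s` violates the Streett condition in all plays from `v`. -/
def PositionalWin (nxt : V → A → B → V) (req resp : ι → V × A × B → Prop) (s : V → A) (v : V) :
    Prop :=
  ∀ (x : ℕ → V) (β : ℕ → B), x 0 = v → (∀ t, x (t + 1) = nxt (x t) (s (x t)) (β t)) →
    ¬ Streett req resp fun t => (x t, s (x t), β t)

variable {nxt : V → A → B → V} {req resp : ι → V × A × B → Prop}

theorem PositionalWin.step {s : V → A} {v : V} (h : PositionalWin nxt req resp s v) (b : B) :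
    PositionalWin nxt req resp s (nxt v (s v) b) := by
  intro x β hx hstep hS
  refine h (fun t => Nat.casesOn t v x) (fun t => Nat.casesOn t b β) rfl ?_ ?_
  · rintro (_ | t)
    · exact hx
    · exact hstep t
  · exact (Streett.shift_iff 1).1 hS

/-- A play that follows a winning strategy on a set of steps `p`, and is suspended otherwise,
satisfies the Streett condition on these steps. -/
theorem frequently_resp_of_component {al : V → Set A} {w : V} {σ : List A → B}
    (hσ : ∀ (x : ℕ → V) (α : ℕ → A), x 0 = w → (∀ t, α t ∈ al (x t)) →
      (∀ t, x (t + 1) = nxt (x t) (α t) (σ (hist α (t + 1)))) →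
        Streett req resp fun t => (x t, α t, σ (hist α (t + 1))))
    (p : ℕ → Prop) (α : ℕ → A) (c : ℕ → V × List A) (e : ℕ → V × A × B)
    (h0 : c 0 = (w, []))
    (hp : ∀ t, p t → c (t + 1) = (nxt (c t).1 (α t) (σ (α t :: (c t).2)), α t :: (c t).2))
    (hn : ∀ t, ¬ p t → c (t + 1) = c t)
    (he : ∀ t, p t → e t = ((c t).1, α t, σ (α t :: (c t).2)))
    (hal : ∀ t, p t → α t ∈ al (c t).1) (i : ι)
    (hreq : ∃ᶠ t in atTop, p t ∧ req i (e t)) : ∃ᶠ t in atTop, resp i (e t) := by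
  classical
  have hinf : {t | p t}.Infinite :=
    Nat.frequently_atTop_iff_infinite.1 (hreq.mono fun t ht => ht.1)
  -- Deleting the suspended steps leaves a genuine play against `σ`; `Nat.nth p` lists the steps at
  -- which it moves.
  set α' : ℕ → A := fun k => α (Nat.nth p k) with hα'
  let x' : ℕ → V := fun k => (c (Nat.nth p k)).1
  have key : ∀ t, (c t).2 = hist α' (Nat.count p t) := by
    intro t
    induction t with
    | zero => simp [h0, hist]
    | succ t ih =>
      by_cases h : p t
      · rw [hp t h, Nat.count_succ, if_pos h]
        simp only [hist, hα', Nat.nth_count h]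
        rw [ih]
      · rw [hn t h, Nat.count_succ, if_neg h]
        exact ih
  have hconst : ∀ s t, s ≤ t → (∀ u, s ≤ u → u < t → ¬ p u) → c t = c s := by
    intro s t hst
    induction t, hst using Nat.le_induction with
    | base => simp
    | succ t hst ih =>
      intro h
      rw [hn t (h t hst (Nat.lt_succ_self t)), ih fun u hu hut => h u hu (Nat.lt_succ_of_lt hut)]
  have hpn : ∀ k, p (Nat.nth p k) := fun k => Nat.nth_mem_of_infinite hinf k
  have hcn : ∀ k, (c (Nat.nth p k)).2 = hist α' k := by
    intro k
    rw [key, Nat.count_nth_of_infinite hinf]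
  have hS := hσ x' α' ?_ ?_ ?_
  · have hek : ∀ k, e (Nat.nth p k) = (x' k, α' k, σ (hist α' (k + 1))) := by
      intro k
      rw [he _ (hpn k), hcn k]
      rfl
    have h1 : ∃ᶠ k in atTop, req i (e (Nat.nth p k)) := by
      rw [frequently_atTop] at hreq ⊢
      intro N
      obtain ⟨t, ht, hpt, hr⟩ := hreq (Nat.nth p N)
      refine ⟨Nat.count p t, ?_, ?_⟩
      · rw [← Nat.count_nth_of_infinite hinf N]
        exact Nat.count_monotone p ht
      · rwa [Nat.nth_count hpt]
    simp only [hek] at h1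
    have h2 := hS i h1
    simp only [← hek] at h2
    rw [frequently_atTop] at h2 ⊢
    intro N
    obtain ⟨k, hk, hr⟩ := h2 N
    exact ⟨_, hk.trans ((Nat.nth_strictMono hinf).le_apply), hr⟩
  · have := hconst 0 (Nat.nth p 0) (Nat.zero_le _) fun u _ hu => by
      intro hpu
      have := Nat.nth_count hpu
      have h2 : Nat.nth p 0 ≤ Nat.nth p (Nat.count p u) :=
        (Nat.nth_strictMono hinf).monotone (Nat.zero_le _)
      omega
    simp only [x', this, h0]
  · exact fun k => hal _ (hpn k)
  · intro k
    have h1 := hconst (Nat.nth p k + 1) (Nat.nth p (k + 1))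
      ((Nat.nth_strictMono hinf) (Nat.lt_succ_self k)) fun u hu hu' hpu => by
        have e1 := Nat.nth_count hpu
        rw [← e1] at hu hu'
        have h3 := (Nat.nth_strictMono hinf).lt_iff_lt.1 hu'
        have h4 := (Nat.nth_strictMono hinf).lt_iff_lt.1 (Nat.lt_of_succ_le hu)
        omega
    simp only [x', h1, hp _ (hpn k), hcn k]
    rfl

/-! ### Interleaving two winning strategies at a vertex. -/

section Split

variable [DecidableEq V] [DecidableEq A] (nxt) (vs : V) (a₁ : A) (σ₁ σ₂ : List A → B)

/-- Which of two suspended plays is continued when the move `a` is made: it is chosen anew at each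
visit of `vs`, where the first play handles the move `a₁`. -/
def splitSel (c : (V × List A) × (V × List A) × Bool) (a : A) : Bool :=
  if (if c.2.2 then c.1.1 else c.2.1.1) = vs then decide (a = a₁) else c.2.2

/-- The answer of the strategy that interleaves `σ₁` and `σ₂`. -/
def splitOut (c : (V × List A) × (V × List A) × Bool) (a : A) : B :=
  if splitSel vs a₁ c a then σ₁ (a :: c.1.2) else σ₂ (a :: c.2.1.2)

/-- The state of the strategy that interleaves `σ₁` and `σ₂`. -/
def splitStep (c : (V × List A) × (V × List A) × Bool) (a : A) :
    (V × List A) × (V × List A) × Bool :=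
  if splitSel vs a₁ c a then ((nxt c.1.1 a (σ₁ (a :: c.1.2)), a :: c.1.2), c.2.1, true)
  else (c.1, (nxt c.2.1.1 a (σ₂ (a :: c.2.1.2)), a :: c.2.1.2), false)

/-- The state of the interleaving strategy after a history. -/
def splitConf (w : V) : List A → (V × List A) × (V × List A) × Bool
  | [] => ((w, []), (vs, []), true)
  | a :: h => splitStep nxt vs a₁ σ₁ σ₂ (splitConf w h) a

/-- The strategy that interleaves `σ₁` and `σ₂`. -/
def splitStrategy (w : V) : List A → B
  | [] => σ₁ []
  | a :: h => splitOut vs a₁ σ₁ σ₂ (splitConf nxt vs a₁ σ₁ σ₂ w h) a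

/-- The active one of the two suspended plays is at `y`, and the other one at `vs`. -/
def SplitInv (c : (V × List A) × (V × List A) × Bool) (y : V) : Prop :=
  (c.2.2 = true ∧ c.1.1 = y ∧ c.2.1.1 = vs) ∨ (c.2.2 = false ∧ c.2.1.1 = y ∧ c.1.1 = vs)

-- The selection can change only when the active play stands at `vs`. The suspended play is waiting
-- there too, so either of them can carry on the actual play.
variable {vs} in
theorem SplitInv.sel {c : (V × List A) × (V × List A) × Bool} {y : V} (h : SplitInv vs c y)
    (a : A) :
    (splitSel vs a₁ c a = true ∧ c.1.1 = y ∧ c.2.1.1 = vs ∧ (y = vs → a = a₁)) ∨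
      (splitSel vs a₁ c a = false ∧ c.2.1.1 = y ∧ c.1.1 = vs ∧ (y = vs → a ≠ a₁)) := by
  obtain ⟨⟨p, l⟩, ⟨q, l'⟩, b⟩ := c
  simp only [SplitInv, splitSel] at h ⊢
  rcases h with ⟨rfl, rfl, rfl⟩ | ⟨rfl, rfl, rfl⟩
  · by_cases hv : p = q <;> by_cases ha : a = a₁ <;> simp [hv, ha]
  · by_cases hv : q = p <;> by_cases ha : a = a₁ <;> simp [hv, ha]

end Split

/-- Streett conditions are closed under shuffling: a request that recurs forever recurs forever in
one of the two interleaved plays, and that play supplies the responses. Each play meets only the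
moves at `vs` that it is prepared for. -/
theorem OWins.split {al al₁ al₂ : V → Set A} {vs w : V} {a₁ : A}
    (h₁ : ∀ v a, a ∈ al v → (v = vs → a = a₁) → a ∈ al₁ v)
    (h₂ : ∀ v a, a ∈ al v → (v = vs → a ≠ a₁) → a ∈ al₂ v)
    (hw : OWins nxt req resp al₁ w) (hvs : OWins nxt req resp al₂ vs) :
    OWins nxt req resp al w := by
  classical
  obtain ⟨σ₁, hσ₁⟩ := hw
  obtain ⟨σ₂, hσ₂⟩ := hvs
  refine ⟨splitStrategy nxt vs a₁ σ₁ σ₂ w, fun x α hx hα hstep => ?_⟩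
  set c : ℕ → (V × List A) × (V × List A) × Bool :=
    fun t => splitConf nxt vs a₁ σ₁ σ₂ w (hist α t) with hc
  have hc1 : ∀ t, c (t + 1) = splitStep nxt vs a₁ σ₁ σ₂ (c t) (α t) := fun t => rfl
  have hout : ∀ t, splitStrategy nxt vs a₁ σ₁ σ₂ w (hist α (t + 1)) =
      splitOut vs a₁ σ₁ σ₂ (c t) (α t) := fun t => rfl
  simp only [hout] at hstep ⊢
  have inv : ∀ t, SplitInv vs (c t) (x t) := by
    intro t
    induction t with
    | zero => exact Or.inl ⟨rfl, hx.symm, rfl⟩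
    | succ t ih =>
      rw [hc1, hstep, splitStep, splitOut]
      rcases ih.sel a₁ (α t) with ⟨h, e1, e2, -⟩ | ⟨h, e1, e2, -⟩
      · rw [if_pos h, if_pos h, ← e1]
        exact Or.inl ⟨rfl, rfl, e2⟩
      · rw [if_neg (by simp [h]), if_neg (by simp [h]), ← e1]
        exact Or.inr ⟨rfl, rfl, e2⟩
  have hp : ∀ t, splitSel vs a₁ (c t) (α t) = true → (c t).1.1 = x t ∧ (x t = vs → α t = a₁) := by
    intro t ht
    rcases (inv t).sel a₁ (α t) with ⟨h, e1, e2, e3⟩ | ⟨h, e1, e2, e3⟩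
    · exact ⟨e1, e3⟩
    · simp [h] at ht
  have hn : ∀ t, ¬ splitSel vs a₁ (c t) (α t) = true →
      (c t).2.1.1 = x t ∧ (x t = vs → α t ≠ a₁) := by
    intro t ht
    rcases (inv t).sel a₁ (α t) with ⟨h, e1, e2, e3⟩ | ⟨h, e1, e2, e3⟩
    · simp [h] at ht
    · exact ⟨e1, e3⟩
  intro i hreq
  have hor : ∃ᶠ t in atTop,
      (splitSel vs a₁ (c t) (α t) = true ∧
          req i (x t, α t, splitOut vs a₁ σ₁ σ₂ (c t) (α t))) ∨
        (¬ splitSel vs a₁ (c t) (α t) = true ∧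
          req i (x t, α t, splitOut vs a₁ σ₁ σ₂ (c t) (α t))) :=
    hreq.mono fun t ht => by
      by_cases h : splitSel vs a₁ (c t) (α t) = true
      · exact Or.inl ⟨h, ht⟩
      · exact Or.inr ⟨h, ht⟩
  rw [frequently_or_distrib] at hor
  rcases hor with h | h
  · refine frequently_resp_of_component hσ₁ (fun t => splitSel vs a₁ (c t) (α t) = true) α
      (fun t => (c t).1) (fun t => (x t, α t, splitOut vs a₁ σ₁ σ₂ (c t) (α t))) rfl ?_ ?_ ?_ ?_ i h
    · intro t ht
      simp only [hc1, splitStep, if_pos ht]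
    · intro t ht
      simp only [hc1, splitStep, if_neg ht]
    · intro t ht
      simp only [splitOut, if_pos ht, (hp t ht).1]
    · intro t ht
      rw [(hp t ht).1]
      exact h₁ _ _ (hα t) (hp t ht).2
  · refine frequently_resp_of_component hσ₂ (fun t => ¬ splitSel vs a₁ (c t) (α t) = true) α
      (fun t => (c t).2.1) (fun t => (x t, α t, splitOut vs a₁ σ₁ σ₂ (c t) (α t))) rfl
      ?_ ?_ ?_ ?_ i h
    · intro t ht
      simp only [hc1, splitStep, if_neg ht]
    · intro t ht
      simp only [hc1, splitStep, if_pos (not_not.1 ht)]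
    · intro t ht
      simp only [splitOut, if_neg ht, (hn t ht).1]
    · intro t ht
      rw [(hn t ht).1]
      exact h₂ _ _ (hα t) (hn t ht).2

/-- A winning strategy for restricted opponents avoids the vertices from which such an opponent
wins, hence moves at such a vertex need not be restricted. -/
theorem OWins.of_positionalWin {al al' : V → Set A} {vs w : V} {s : V → A}
    (hs : ∀ v, s v ∈ al' v) (hwin : PositionalWin nxt req resp s vs)
    (hal : ∀ v, v ≠ vs → al v ⊆ al' v) (hw : OWins nxt req resp al' w) :
    OWins nxt req resp al w := by
  classical
  obtain ⟨σ, hσ⟩ := hw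
  refine ⟨σ, fun x α hx hα hstep => ?_⟩
  by_cases hvis : ∃ T, x T = vs
  · exfalso
    set T := Nat.find hvis with hT
    have hTv : x T = vs := Nat.find_spec hvis
    have hlt : ∀ t < T, x t ≠ vs := fun t ht => Nat.find_min hvis ht
    -- The opponent copies `α` up to the first visit `T` of `vs` and plays `s` from then on; `h'` is
    -- the continuation together with its history. All these moves lie in `al'`, yet `s` wins.
    let h' : ℕ → V × List A := fun t => Nat.rec (vs, hist α T)
      (fun _ c => (nxt c.1 (s c.1) (σ (s c.1 :: c.2)), s c.1 :: c.2)) t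
    let α' : ℕ → A := fun t => if t < T then α t else s (h' (t - T)).1
    let x' : ℕ → V := fun t => if t < T then x t else (h' (t - T)).1
    have hh : ∀ t, hist α' (t + T) = (h' t).2 := by
      intro t
      induction t with
      | zero =>
        rw [zero_add]
        exact hist_congr fun u hu => by simp [α', hu]
      | succ t ih =>
        rw [Nat.add_right_comm, hist, ih]
        simp [α', h']
    have hx'T : ∀ t, x' (t + T) = (h' t).1 := by intro t; simp [x']
    have hα'T : ∀ t, α' (t + T) = s (h' t).1 := by intro t; simp [α']
    have hS := hσ x' α' ?_ ?_ ?_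
    · rw [← Streett.shift_iff T] at hS
      refine hwin (fun t => (h' t).1) (fun t => σ (hist α' (t + T + 1))) rfl ?_ ?_
      · intro t
        rw [hist, hh, hα'T]
      · simpa only [hx'T, hα'T] using hS
    · by_cases h0 : 0 < T
      · simp [x', h0, hx]
      · have : T = 0 := by omega
        simp only [x', h0, if_false]
        rw [← hx, ← this, hTv, Nat.sub_self]
        rfl
    · intro t
      by_cases ht : t < T
      · simp only [α', x', ht, if_true]
        exact hal _ (hlt t ht) (hα t)
      · simp only [α', x', ht, if_false]
        exact hs _
    · intro t
      by_cases ht : t < T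
      · have e1 : hist α' (t + 1) = hist α (t + 1) := hist_congr fun u hu => by
          have : u < T := by omega
          simp [α', this]
        have e2 : x' (t + 1) = x (t + 1) := by
          by_cases h1 : t + 1 < T
          · simp [x', h1]
          · have h2 : t + 1 = T := by omega
            have := hx'T 0
            rw [zero_add] at this
            rw [h2, this, hTv]
            rfl
        rw [e1, e2, hstep t]
        simp [x', α', ht]
      · obtain ⟨u, rfl⟩ : ∃ u, t = u + T := ⟨t - T, by omega⟩
        rw [Nat.add_right_comm, hx'T, hx'T, hα'T, Nat.add_right_comm, hist, hh, hα'T]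
  · push Not at hvis
    exact hσ x α hx (fun t => hal _ (hvis t) (hα t)) hstep

/-- Determinacy of Streett games on finite arenas, where the player who violates the condition
has positional winning strategies. -/
theorem determinacy [Finite V] [Finite A] (nxt : V → A → B → V) (req resp : ι → V × A × B → Prop)
    (al : V → Set A) (hal : ∀ v, (al v).Nonempty) (v : V) :
    OWins nxt req resp al v ∨
      ∃ s : V → A, (∀ v, s v ∈ al v) ∧ PositionalWin nxt req resp s v := by
  classical
  have := Fintype.ofFinite V
  have := Fintype.ofFinite A
  induction hN : ∑ v, (al v).ncard using Nat.strong_induction_on generalizing al v with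
  | _ N IH =>
  by_cases hsing : ∀ v, ∃ a, al v = {a}
  · choose s hs using hsing
    by_cases hw : PositionalWin nxt req resp s v
    · exact Or.inr ⟨s, fun v => by simp [hs], hw⟩
    · left
      unfold PositionalWin at hw
      push Not at hw
      obtain ⟨x, β, hx, hstep, hS⟩ := hw
      -- The opponent has no choice, so a fixed answer sequence can be replayed by the clock. The
      -- answer at time `t` is given after `t + 1` moves, hence the `- 1`.
      refine ⟨fun h => β (h.length - 1), fun x' α hx' hα hstep' => ?_⟩
      have hlen : ∀ t, (hist α t).length = t := by
        intro t
        induction t with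
        | zero => rfl
        | succ t ih => simp [hist, ih]
      simp only [hlen, Nat.add_sub_cancel] at hstep' ⊢
      have hαs : ∀ t, α t = s (x' t) := by
        intro t
        have := hα t
        rwa [hs] at this
      have hxx : ∀ t, x' t = x t := by
        intro t
        induction t with
        | zero => rw [hx, hx']
        | succ t ih => rw [hstep', hstep, hαs, ih]
      simpa only [hαs, hxx] using hS
  · push Not at hsing
    obtain ⟨vs, hvs⟩ := hsing
    obtain ⟨a₁, ha₁⟩ := hal vs
    obtain ⟨a₂, ha₂, hne⟩ : ∃ a₂ ∈ al vs, a₂ ≠ a₁ := by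
      by_contra! hcon
      exact hvs a₁ (Set.eq_singleton_iff_unique_mem.2 ⟨ha₁, hcon⟩)
    -- Splitting the moves at `vs` into `a₁` and the rest gives two games with fewer moves in total,
    -- to which the induction applies.
    set al₁ : V → Set A := Function.update al vs {a₁} with hal₁
    set al₂ : V → Set A := Function.update al vs (al vs \ {a₁}) with hal₂
    have sub₁ : ∀ v, al₁ v ⊆ al v := by
      intro v
      by_cases h : v = vs
      · subst h; simpa [hal₁] using ha₁
      · simp [hal₁, h]
    have sub₂ : ∀ v, al₂ v ⊆ al v := by
      intro v
      by_cases h : v = vs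
      · subst h; simp [hal₂]
      · simp [hal₂, h]
    have lt : ∀ al' : V → Set A, (∀ v, al' v ⊆ al v) → al' vs ≠ al vs →
        ∑ v, (al' v).ncard < N := by
      intro al' hsub hss
      rw [← hN]
      exact Finset.sum_lt_sum (fun v _ => Set.ncard_le_ncard (hsub v) (Set.toFinite _))
        ⟨vs, Finset.mem_univ _, Set.ncard_lt_ncard ((hsub vs).ssubset_of_ne hss) (Set.toFinite _)⟩
    have lt₁ := lt al₁ sub₁ (by
      intro h
      have : a₂ ∈ al₁ vs := h ▸ ha₂
      simp [hal₁, hne] at this)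
    have lt₂ := lt al₂ sub₂ (by
      intro h
      have : a₁ ∈ al₂ vs := h ▸ ha₁
      simp [hal₂] at this)
    have ne₁ : ∀ v, (al₁ v).Nonempty := by
      intro v
      by_cases h : v = vs
      · subst h; simp [hal₁]
      · simpa [hal₁, h] using hal v
    have ne₂ : ∀ v, (al₂ v).Nonempty := by
      intro v
      by_cases h : v = vs
      · subst h; exact ⟨a₂, by simp [hal₂, ha₂, hne]⟩
      · simpa [hal₂, h] using hal v
    rcases IH _ lt₁ al₁ ne₁ v rfl with hO | ⟨s, hs, hw⟩
    swap
    · exact Or.inr ⟨s, fun v => sub₁ v (hs v), hw⟩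
    rcases IH _ lt₂ al₂ ne₂ vs rfl with hO' | ⟨s, hs, hw⟩
    · left
      refine OWins.split (a₁ := a₁) ?_ ?_ hO hO'
      · intro v a ha h
        by_cases hv : v = vs
        · subst hv; simp [hal₁, h rfl]
        · simpa [hal₁, hv] using ha
      · intro v a ha h
        by_cases hv : v = vs
        · subst hv; simp [hal₂, h rfl, ha]
        · simpa [hal₂, hv] using ha
    -- Here the opponent wins from `vs` without using `a₁`, so the game without `a₁` already decides
    -- the winner from `v`.
    · rcases IH _ lt₂ al₂ ne₂ v rfl with hO'' | ⟨s', hs', hw'⟩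
      · exact Or.inl (OWins.of_positionalWin hs hw
          (fun v hv => by simp [hal₂, hv]) hO'')
      · exact Or.inr ⟨s', fun v => sub₂ v (hs' v), hw'⟩

end StreettGame

/-! ### Streett games with costs: counters and increasing bounds. -/

/-- Summary of an infix of a run with respect to one Streett pair: whether there is a response,
whether there is a request without later response, whether there is an increment. -/
abbrev BlockTag : Type := Bool × Bool × Bool

namespace BlockTag

/-- The infix contains a response. -/
abbrev resp (d : BlockTag) : Prop := d.1 = true

/-- The infix contains a request without response up to the end of the infix. -/
abbrev opn (d : BlockTag) : Prop := d.2.1 = true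

/-- The infix contains an increment. -/
abbrev inc (d : BlockTag) : Prop := d.2.2 = true

end BlockTag

namespace CostGame

open Filter StreettGame

variable {J : Type*}

/-- The number of infixes with an increment among those with index in `[s, t)`. -/
def incCount (d : ℕ → BlockTag) (s t : ℕ) : ℕ :=
  ((Finset.Ico s t).filter fun u => (d u).inc).card

theorem incCount_self (d : ℕ → BlockTag) (s : ℕ) : incCount d s s = 0 := by simp [incCount]

theorem incCount_succ (d : ℕ → BlockTag) {s t : ℕ} (h : s ≤ t) :
    incCount d s (t + 1) = incCount d s t + if (d t).inc then 1 else 0 := by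
  unfold incCount
  rw [← Finset.insert_Ico_right_eq_Ico_add_one h, Finset.filter_insert]
  split_ifs
  · rw [Finset.card_insert_of_notMem (by simp)]
  · rfl

theorem incCount_mono (d : ℕ → BlockTag) {s t t' : ℕ} (h : t ≤ t') :
    incCount d s t ≤ incCount d s t' :=
  Finset.card_le_card (Finset.filter_subset_filter _ (Finset.Ico_subset_Ico_right h))

/-- The sequence satisfies the Streett condition with costs, where the cost of a response is
measured by the number of infixes with increments. -/
def Good (D : ℕ → J → BlockTag) : Prop :=
  ∃ b N, ∀ j, ∀ t ≥ N, (D t j).opn →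
    ∃ t' > t, (D t' j).resp ∧ incCount (fun u => D u j) (t + 1) t' ≤ b

/-- Update of a counter that is zero if no request is pending, and one more than the cost of the
oldest pending request otherwise. -/
def ctrStep (c : ℕ) (d : BlockTag) : ℕ :=
  if c ≠ 0 ∧ ¬ d.resp then (if d.inc then c + 1 else c) else if d.opn then 1 else 0

/-- A nonzero counter is traced back to the request that last set it to one; since then only
increments were added. An overflow thus exhibits an expensive request. -/
theorem exists_request_of_ctr {c : ℕ → ℕ} {d : ℕ → BlockTag} {T s : ℕ} (hT : c T = 0)
    (hTs : T ≤ s) (hstep : ∀ t, T ≤ t → t < s → c (t + 1) = ctrStep (c t) (d t))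
    (hs : c s ≠ 0) :
    ∃ t₀, T ≤ t₀ ∧ t₀ < s ∧ (d t₀).opn ∧ (∀ t, t₀ < t → t < s → ¬ (d t).resp) ∧
      c s = 1 + incCount d (t₀ + 1) s := by
  induction s, hTs using Nat.le_induction with
  | base => exact absurd hT hs
  | succ s hTs ih =>
    have h1 := hstep s hTs (Nat.lt_succ_self s)
    rw [ctrStep] at h1
    by_cases hc : c s ≠ 0 ∧ ¬ (d s).resp
    · rw [if_pos hc] at h1
      obtain ⟨t₀, a1, a2, a3, a4, a5⟩ := ih (fun t h h' => hstep t h (by omega)) hc.1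
      refine ⟨t₀, a1, by omega, a3, ?_, ?_⟩
      · intro t ht ht'
        rcases Nat.lt_succ_iff_lt_or_eq.1 ht' with h | rfl
        · exact a4 t ht h
        · exact hc.2
      · rw [incCount_succ d (by omega : t₀ + 1 ≤ s), h1, a5]
        split_ifs <;> omega
    · rw [if_neg hc] at h1
      by_cases ho : (d s).opn
      · rw [if_pos ho] at h1
        refine ⟨s, hTs, Nat.lt_succ_self s, ho, fun t h h' => by omega, ?_⟩
        rw [incCount_self, h1]
      · rw [if_neg ho] at h1
        exact absurd h1 hs

/-- Only an inequality is available, as the counter may belong to an older pending request. It is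
strict because counters start at one. -/
theorem lt_ctr_of_request {c : ℕ → ℕ} {d : ℕ → BlockTag} {t s : ℕ} (hts : t < s)
    (hstep : ∀ u, t ≤ u → u < s → c (u + 1) = ctrStep (c u) (d u))
    (ho : (d t).opn) (hr : ∀ u, t < u → u < s → ¬ (d u).resp) :
    incCount d (t + 1) s < c s := by
  have hts' : t + 1 ≤ s := hts
  clear hts
  induction s, hts' using Nat.le_induction with
  | base =>
    rw [incCount_self, hstep t le_rfl (Nat.lt_succ_self t), ctrStep]
    split_ifs <;> omega
  | succ s hs ih =>
    have ih := ih (fun u h h' => hstep u h (by omega)) (fun u h h' => hr u h (by omega))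
    have hc : c s ≠ 0 ∧ ¬ (d s).resp := ⟨by omega, hr s hs (Nat.lt_succ_self s)⟩
    rw [incCount_succ d hs, hstep s (by omega) (Nat.lt_succ_self s), ctrStep, if_pos hc]
    split_ifs <;> omega

/-- No counter exceeds the bound for costs at most `b`. -/
def Bounded (b : ℕ) (m : J → ℕ) (D : J → BlockTag) : Prop :=
  ∀ j, ctrStep (m j) (D j) < b + 2

open Classical in
/-- Update of the counters, with a reset when the cost exceeds `b`. -/
noncomputable def monStep (b : ℕ) (m : J → ℕ) (D : J → BlockTag) : J → ℕ :=
  if Bounded b m D then fun j => ctrStep (m j) (D j) else 0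

theorem monStep_lt (b : ℕ) (m : J → ℕ) (D : J → BlockTag) (j : J) : monStep b m D j < b + 2 := by
  unfold monStep
  split_ifs with h
  · exact h j
  · simp

variable {V A B : Type*} (nxt : V → A → B → V) (lab : V → A → B → J → BlockTag)

/-- The moves in the arena with counters. -/
noncomputable def monNext (b : ℕ) (v : V × (J → Fin (b + 2))) (a : A) (β : B) :
    V × (J → Fin (b + 2)) :=
  (nxt v.1 a β, fun j => ⟨monStep b (fun j => (v.2 j : ℕ)) (lab v.1 a β) j, monStep_lt b _ _ j⟩)

/-- The requests of the Streett condition in the arena with counters; exceeding the bound is a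
request without responses. -/
def monReq (b : ℕ) : Option J → (V × (J → Fin (b + 2))) × A × B → Prop
  | none, e => ¬ Bounded b (fun j => (e.1.2 j : ℕ)) (lab e.1.1 e.2.1 e.2.2)
  | some j, e => (lab e.1.1 e.2.1 e.2.2 j).opn

/-- The responses of the Streett condition in the arena with counters. -/
def monResp (b : ℕ) : Option J → (V × (J → Fin (b + 2))) × A × B → Prop
  | none, _ => False
  | some j, e => (lab e.1.1 e.2.1 e.2.2 j).resp

/-- The positional strategy `s` for the arena with counters wins from `v` with counters `m`. -/
def BoundWin (b : ℕ) (s : V → (J → ℕ) → A) (v : V) (m : J → ℕ) : Prop :=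
  ∀ (x : ℕ → V) (μ : ℕ → J → ℕ) (β : ℕ → B), x 0 = v → μ 0 = m →
    (∀ t, x (t + 1) = nxt (x t) (s (x t) (μ t)) (β t)) →
    (∀ t, μ (t + 1) = monStep b (μ t) (lab (x t) (s (x t) (μ t)) (β t))) →
    (∃ᶠ t in atTop, ¬ Bounded b (μ t) (lab (x t) (s (x t) (μ t)) (β t))) ∨
      ∃ j, (∃ᶠ t in atTop, (lab (x t) (s (x t) (μ t)) (β t) j).opn) ∧
        ¬ ∃ᶠ t in atTop, (lab (x t) (s (x t) (μ t)) (β t) j).resp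

variable {nxt lab}

theorem BoundWin.step {b : ℕ} {s : V → (J → ℕ) → A} {v : V} {m : J → ℕ}
    (h : BoundWin nxt lab b s v m) (β₀ : B) :
    BoundWin nxt lab b s (nxt v (s v m) β₀) (monStep b m (lab v (s v m) β₀)) := by
  intro x μ β hx hμ hstep hμstep
  have := h (fun t => Nat.casesOn t v x) (fun t => Nat.casesOn t m μ)
    (fun t => Nat.casesOn t β₀ β) rfl rfl
    (by rintro (_ | t); exacts [hx, hstep t]) (by rintro (_ | t); exacts [hμ, hμstep t])
  rcases this with h | ⟨j, h1, h2⟩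
  · exact Or.inl ((frequently_atTop_add 1).2 h)
  · exact Or.inr ⟨j, (frequently_atTop_add 1).2 h1, fun h3 => h2 ((frequently_atTop_add 1).1 h3)⟩

variable (nxt lab) in
/-- The player who answers moves wins the Streett game with costs from `v`. -/
def OWinsCost (v : V) : Prop :=
  ∃ σ : List A → B, ∀ (x : ℕ → V) (α : ℕ → A), x 0 = v →
    (∀ t, x (t + 1) = nxt (x t) (α t) (σ (hist α (t + 1)))) →
      Good fun t => lab (x t) (α t) (σ (hist α (t + 1)))

variable (nxt lab) in
/-- The player who moves first wins the Streett game with costs from `v`. -/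
def IWinsCost (v : V) : Prop :=
  ∃ τ : List B → A, ∀ (x : ℕ → V) (β : ℕ → B), x 0 = v →
    (∀ t, x (t + 1) = nxt (x t) (τ (hist β t)) (β t)) →
      ¬ Good fun t => lab (x t) (τ (hist β t)) (β t)

/-- Once resets have stopped, the counter dominates the cost of a pending request up to its first
response, and this response exists by the Streett condition. Finiteness of `J` gives a common
threshold. -/
theorem good_of_eventually_bounded [Finite J] {D : ℕ → J → BlockTag} {μ : ℕ → J → ℕ} {b : ℕ}
    (hμ : ∀ t, μ (t + 1) = monStep b (μ t) (D t)) (hlt : ∀ t j, μ t j < b + 2)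
    (hbd : ∀ᶠ t in atTop, Bounded b (μ t) (D t))
    (hS : ∀ j, (∃ᶠ t in atTop, (D t j).opn) → ∃ᶠ t in atTop, (D t j).resp) : Good D := by
  classical
  have h1 : ∀ᶠ t in atTop, ∀ j, (D t j).opn → ∃ᶠ t in atTop, (D t j).resp := by
    rw [eventually_all]
    intro j
    by_cases h : ∃ᶠ t in atTop, (D t j).opn
    · exact Eventually.of_forall fun t _ => hS j h
    · rw [not_frequently] at h
      exact h.mono fun t ht ho => absurd ho ht
  obtain ⟨N, hN⟩ := eventually_atTop.1 (hbd.and h1)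
  refine ⟨b, N, fun j t ht ho => ?_⟩
  have hfr := (hN t ht).2 j ho
  have hex : ∃ t', t < t' ∧ (D t' j).resp := by
    obtain ⟨t', h, h'⟩ := frequently_atTop.1 hfr (t + 1)
    exact ⟨t', h, h'⟩
  have hspec := Nat.find_spec hex
  refine ⟨Nat.find hex, hspec.1, hspec.2, ?_⟩
  have := lt_ctr_of_request (c := fun u => μ u j) (d := fun u => D u j) hspec.1
    (fun u h _ => by
      have hb := (hN u (ht.trans h)).1
      simp only [hμ, monStep, if_pos hb])
    ho (fun u h h' hr => Nat.find_min hex h' ⟨h, hr⟩)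
  have h2 := hlt (Nat.find hex) j
  omega

/-- The counters are computed from the play, so a strategy for the arena with counters is one for
the original arena. -/
theorem OWinsCost.of_streett [Finite J] {b : ℕ} {v : V}
    (h : OWins (monNext nxt lab b) (monReq lab b) (monResp lab b) (fun _ => Set.univ) (v, 0)) :
    OWinsCost nxt lab v := by
  obtain ⟨σ, hσ⟩ := h
  refine ⟨σ, fun x α hx hstep => ?_⟩
  let y : ℕ → V × (J → Fin (b + 2)) := fun t =>
    Nat.rec (v, 0) (fun t p => monNext nxt lab b p (α t) (σ (hist α (t + 1)))) t
  have hy : ∀ t, (y t).1 = x t := by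
    intro t
    induction t with
    | zero => exact hx.symm
    | succ t ih => rw [hstep, ← ih]; rfl
  have hS := hσ y α rfl (fun _ => trivial) (fun t => rfl)
  refine good_of_eventually_bounded (μ := fun t j => ((y t).2 j : ℕ)) (b := b) ?_ ?_ ?_ ?_
  · intro t
    funext j
    rw [← hy]
    rfl
  · exact fun t j => ((y t).2 j).2
  · have := hS none
    simp only [monReq, monResp, frequently_false, imp_false, not_frequently, not_not, hy] at this
    exact this
  · intro j
    have := hS (some j)
    simpa only [monReq, monResp, hy] using this

theorem exists_boundWin_of_not_oWinsCost [Finite V] [Finite A] [Finite J] [Nonempty A] {v : V}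
    (h : ¬ OWinsCost nxt lab v) (b : ℕ) : ∃ s, BoundWin nxt lab b s v 0 := by
  rcases determinacy (monNext nxt lab b) (monReq lab b) (monResp lab b) (fun _ => Set.univ)
    (fun _ => Set.univ_nonempty) (v, 0) with hO | ⟨s, -, hs⟩
  · exact absurd (OWinsCost.of_streett hO) h
  · refine ⟨fun v m => s (v, fun j => Fin.ofNat (b + 2) (m j)), fun x μ β hx hμ hstep hμstep => ?_⟩
    have hlt : ∀ t j, μ t j < b + 2 := by
      rintro (_ | t) j
      · simp [hμ]
      · rw [hμstep]; exact monStep_lt _ _ _ _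
    -- Counters stay below `b + 2`, so the reduction in `Fin.ofNat` changes nothing.
    have hval : ∀ t, (fun j => ((Fin.ofNat (b + 2) (μ t j) : Fin (b + 2)) : ℕ)) = μ t := by
      intro t
      funext j
      simp [Nat.mod_eq_of_lt (hlt t j)]
    have := hs (fun t => (x t, fun j => Fin.ofNat (b + 2) (μ t j))) β
      (by simp only [hx, hμ, Prod.mk.injEq, true_and]; rfl) ?_
    · simp only [Streett, not_forall] at this
      obtain ⟨i, h1, h2⟩ := this
      cases i with
      | none =>
        left
        simpa only [monReq, hval] using h1
      | some j =>
        right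
        exact ⟨j, by simpa only [monReq] using h1, by simpa only [monResp] using h2⟩
    · intro t
      refine Prod.ext (hstep t) ?_
      funext j
      apply Fin.ext
      have e := congrFun (hval (t + 1)) j
      refine Eq.trans e ?_
      simp only [monNext, hval, hμstep]

section Phases

variable (nxt lab) (pick : ℕ → V → ℕ × (V → (J → ℕ) → A))

open Classical in
/-- The configuration of the strategy that plays with increasing bounds: the current vertex, the
current bound and strategy, the current counters. The bound is increased whenever it is
exceeded. -/
noncomputable def phase (v : V) : List B → V × (ℕ × (V → (J → ℕ) → A)) × (J → ℕ)
  | [] => (v, pick 0 v, 0)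
  | β :: h =>
    let c := phase v h
    let a := c.2.1.2 c.1 c.2.2
    let D := lab c.1 a β
    let v' := nxt c.1 a β
    (v', if Bounded c.2.1.1 c.2.2 D then c.2.1 else pick (c.2.1.1 + 1) v',
      monStep c.2.1.1 c.2.2 D)

end Phases

theorem determinacy [Finite V] [Finite A] [Finite J] [Nonempty A] (nxt : V → A → B → V)
    (lab : V → A → B → J → BlockTag) (v₀ : V) : OWinsCost nxt lab v₀ ∨ IWinsCost nxt lab v₀ := by
  classical
  by_contra! hcon
  obtain ⟨hO, hI⟩ := hcon
  apply hI
  -- `Z` collects the vertices where the bound can always be raised further. As `V` is finite,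
  -- winning from a vertex for one bound `b ≥ bs` with empty counters already puts it in `Z`. A
  -- reset empties the counters, so the play is in `Z` again whenever a new bound is needed.
  let Z : Set V := {v | ∀ N, ∃ b ≥ N, ∃ s, BoundWin nxt lab b s v 0}
  have hZ0 : v₀ ∈ Z := fun N => ⟨N, le_rfl, exists_boundWin_of_not_oWinsCost hO N⟩
  obtain ⟨bs, hbs⟩ : ∃ bs, ∀ b ≥ bs, ∀ v, (∃ s, BoundWin nxt lab b s v 0) → v ∈ Z := by
    have : ∀ᶠ b in atTop, ∀ v, (∃ s, BoundWin nxt lab b s v 0) → v ∈ Z := by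
      rw [eventually_all]
      intro v
      by_cases hv : v ∈ Z
      · exact Eventually.of_forall fun _ _ => hv
      · simp only [Z, Set.mem_ofPred_eq, not_forall, not_exists, not_and] at hv
        obtain ⟨N, hN⟩ := hv
        filter_upwards [eventually_ge_atTop N] with b hb ⟨s, hs⟩
        exact absurd hs (hN b hb s)
    exact eventually_atTop.1 this
  have hpick : ∀ N v, ∃ p : ℕ × (V → (J → ℕ) → A), v ∈ Z →
      max N bs ≤ p.1 ∧ BoundWin nxt lab p.1 p.2 v 0 := by
    intro N v
    by_cases hv : v ∈ Z
    · obtain ⟨b, hb, s, hs⟩ := hv (max N bs)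
      exact ⟨(b, s), fun _ => ⟨hb, hs⟩⟩
    · exact ⟨(0, fun _ _ => Classical.arbitrary A), fun h => absurd h hv⟩
  choose pick hpick using hpick
  refine ⟨fun h => let c := phase nxt lab pick v₀ h; c.2.1.2 c.1 c.2.2,
    fun x β hx hstep hgood => ?_⟩
  set c : ℕ → V × (ℕ × (V → (J → ℕ) → A)) × (J → ℕ) :=
    fun t => phase nxt lab pick v₀ (hist β t) with hc
  simp only at hstep hgood
  have hxc : ∀ t, (c t).1 = x t := by
    intro t
    induction t with
    | zero => exact hx.symm
    | succ t ih => rw [hstep, ← ih]; rfl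
  let r : ℕ → ℕ := fun t => (c t).2.1.1
  let s : ℕ → V → (J → ℕ) → A := fun t => (c t).2.1.2
  let μ : ℕ → J → ℕ := fun t => (c t).2.2
  let D : ℕ → J → BlockTag := fun t => lab (x t) (s t (x t) (μ t)) (β t)
  have hstep' : ∀ t, x (t + 1) = nxt (x t) (s t (x t) (μ t)) (β t) := fun t => by
    rw [hstep]
    simp only [s, μ, ← hxc]
    rfl
  have hD : (fun t => lab (x t) ((c t).2.1.2 (c t).1 (c t).2.2) (β t)) = D := by
    funext t
    simp only [D, s, μ, hxc]
  change Good (fun t => lab (x t) ((c t).2.1.2 (c t).1 (c t).2.2) (β t)) at hgood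
  rw [hD] at hgood
  have hμ : ∀ t, μ (t + 1) = monStep (r t) (μ t) (D t) := fun t => by
    simp only [D, ← hxc]
    rfl
  have hrs : ∀ t, (r (t + 1), s (t + 1)) =
      if Bounded (r t) (μ t) (D t) then (r t, s t) else pick (r t + 1) (x (t + 1)) := fun t => by
    simp only [D, ← hxc]
    rfl
  have inv : ∀ t, bs ≤ r t ∧ BoundWin nxt lab (r t) (s t) (x t) (μ t) := by
    intro t
    induction t with
    | zero =>
      rw [hx]
      have := hpick 0 v₀ hZ0
      exact ⟨(le_max_right _ _).trans this.1, this.2⟩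
    | succ t ih =>
      have h1 := ih.2.step (β t)
      rw [← hstep'] at h1
      have h2 : BoundWin nxt lab (r t) (s t) (x (t + 1)) (μ (t + 1)) := by
        rw [hμ]; exact h1
      have h3 := hrs t
      by_cases hb : Bounded (r t) (μ t) (D t)
      · rw [if_pos hb, Prod.mk.injEq] at h3
        rw [h3.1, h3.2]
        exact ⟨ih.1, h2⟩
      · have h0 : μ (t + 1) = 0 := by rw [hμ, monStep, if_neg hb]
        rw [if_neg hb] at h3
        rw [h0] at h2 ⊢
        have := hpick (r t + 1) (x (t + 1)) (hbs _ ih.1 _ ⟨_, h2⟩)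
        rw [← h3] at this
        exact ⟨(le_max_right _ _).trans this.1, this.2⟩
  have hrinc : ∀ t, ¬ Bounded (r t) (μ t) (D t) → r t < r (t + 1) ∧ μ (t + 1) = 0 := by
    intro t hb
    have h0 : μ (t + 1) = 0 := by rw [hμ, monStep, if_neg hb]
    refine ⟨?_, h0⟩
    have h2 := (inv t).2.step (β t)
    rw [← hstep'] at h2
    have h2 : BoundWin nxt lab (r t) (s t) (x (t + 1)) (μ (t + 1)) := by
      rw [hμ]; exact h2
    rw [h0] at h2
    have := (hpick (r t + 1) (x (t + 1)) (hbs _ (inv t).1 _ ⟨_, h2⟩)).1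
    have h3 := hrs t
    rw [if_neg hb] at h3
    rw [← h3] at this
    have := (le_max_left _ _).trans this
    exact this
  have hrmono : Monotone r := by
    refine monotone_nat_of_le_succ fun t => ?_
    by_cases hb : Bounded (r t) (μ t) (D t)
    · have h3 := hrs t
      rw [if_pos hb, Prod.mk.injEq] at h3
      exact h3.1.ge
    · exact (hrinc t hb).1.le
  by_cases hov : ∃ᶠ t in atTop, ¬ Bounded (r t) (μ t) (D t)
  · rw [frequently_atTop] at hov
    obtain ⟨b, N, hg⟩ := hgood
    have hlarge : ∀ K, ∃ t ≥ N, K ≤ r t := by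
      intro K
      induction K with
      | zero => exact ⟨N, le_rfl, Nat.zero_le _⟩
      | succ K ih =>
        obtain ⟨t, ht, hK⟩ := ih
        obtain ⟨t', ht', hb⟩ := hov t
        have h1 := hrmono ht'
        have h2 := (hrinc t' hb).1
        exact ⟨t' + 1, by omega, by omega⟩
    -- Take a reset `T₂` after the bound has reached `b`, and the next overflow `T`. The overflow
    -- stems from a request after `T₂` that is pending at cost above `r T ≥ b`.
    obtain ⟨T₁, hT₁, hr₁⟩ := hlarge b
    obtain ⟨T₂, hT₂, hb₂⟩ := hov T₁
    have hex : ∃ T, T₂ + 1 ≤ T ∧ ¬ Bounded (r T) (μ T) (D T) := hov (T₂ + 1)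
    obtain ⟨hle, hb₃⟩ := Nat.find_spec hex
    have hmin : ∀ t, T₂ + 1 ≤ t → t < Nat.find hex → Bounded (r t) (μ t) (D t) := by
      intro t h1 h2
      by_contra h3
      exact Nat.find_min hex h2 ⟨h1, h3⟩
    set T := Nat.find hex
    have hb₃' := hb₃
    simp only [Bounded, not_forall, not_lt] at hb₃'
    obtain ⟨j, hj⟩ := hb₃'
    obtain ⟨t₀, a1, a2, a3, a4, a5⟩ := exists_request_of_ctr
      (c := fun t => if t ≤ T then μ t j else ctrStep (μ T j) (D T j))
      (d := fun t => D t j) (T := T₂ + 1) (s := T + 1)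
      (by simp only [if_pos hle]; rw [(hrinc T₂ hb₂).2]; rfl) (by omega)
      (by
        intro t h1 h2
        rcases Nat.lt_succ_iff_lt_or_eq.1 h2 with h3 | rfl
        · simp only [if_pos (Nat.succ_le_of_lt h3), if_pos h3.le]
          rw [hμ, monStep, if_pos (hmin t h1 h3)]
        · simp)
      (by simp only [Nat.not_succ_le_self, if_false]; omega)
    simp only [Nat.not_succ_le_self, if_false] at a5
    obtain ⟨t', ht', hr', hinc⟩ := hg j t₀ (by omega) a3
    have h1 : T + 1 ≤ t' := by
      by_contra h2
      exact a4 t' ht' (by omega) hr'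
    have h2 := incCount_mono (fun u => D u j) (s := t₀ + 1) h1
    have h3 := hrmono (show T₁ ≤ T by omega)
    omega
  -- From `T` on the bound and the strategy are fixed, so the play is eventually one against a
  -- single `BoundWin` strategy without overflows.
  · rw [not_frequently, eventually_atTop] at hov
    obtain ⟨T, hT⟩ := hov
    simp only [not_not] at hT
    have hconst : ∀ t, r (t + T) = r T ∧ s (t + T) = s T := by
      intro t
      induction t with
      | zero => simp
      | succ t ih =>
        have h3 := hrs (t + T)
        rw [if_pos (hT _ (by omega)), Prod.mk.injEq] at h3
        rw [Nat.add_right_comm, h3.1, h3.2]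
        exact ih
    have hDT : ∀ t, D (t + T) =
        lab (x (t + T)) (s T (x (t + T)) (μ (t + T))) (β (t + T)) := by
      intro t
      simp only [D, (hconst t).2]
    have := (inv T).2 (fun t => x (t + T)) (fun t => μ (t + T)) (fun t => β (t + T))
      (by simp) (by simp)
      (fun t => by
        have := hstep' (t + T)
        rw [(hconst t).2] at this
        rw [Nat.add_right_comm, this])
      (fun t => by
        have := hμ (t + T)
        rw [(hconst t).1, hDT] at this
        rw [Nat.add_right_comm, this])
    simp only [← hDT] at this
    rcases this with h | ⟨j, h1, h2⟩
    · obtain ⟨t, ht⟩ := h.exists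
      refine ht ?_
      have := hT (t + T) (by omega)
      rwa [(hconst t).1] at this
    · rw [frequently_atTop_add (p := fun t => (D t j).opn)] at h1
      rw [frequently_atTop_add (p := fun t => (D t j).resp), not_frequently,
        eventually_atTop] at h2
      obtain ⟨N', hN'⟩ := h2
      obtain ⟨b, N, hg⟩ := hgood
      obtain ⟨t, ht, ho⟩ := frequently_atTop.1 h1 (max N N')
      obtain ⟨t', ht', hr, -⟩ := hg j t ((le_max_left _ _).trans ht) ho
      exact hN' t' (((le_max_right _ _).trans ht).trans ht'.le) hr

end CostGame

/-! ### Summaries of blocks of a run, and the language in terms of them. -/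

namespace StreettAutomaton

open Filter CostGame

variable {Q A J : Type*} (𝒜 : StreettAutomaton Q A J)

open Classical in
/-- The transition function on states together with summaries of the run so far. -/
noncomputable def tagStep (p : Q × (J → BlockTag)) (a : A) : Q × (J → BlockTag) :=
  (𝒜.δ p.1 a, fun j =>
    -- The source state `p.1` is recorded, not the target, so consecutive blocks partition the
    -- positions. A response also answers a request at the same position.
    (decide ((p.2 j).resp ∨ p.1 ∈ 𝒜.response j),
      decide (((p.2 j).opn ∨ p.1 ∈ 𝒜.request j) ∧ p.1 ∉ 𝒜.response j),
      decide ((p.2 j).inc ∨ 𝒜.cst j p.1 a = TransitionCost.inc)))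

/-- The state with an empty summary. -/
def tagInit (q : Q) : Q × (J → BlockTag) := (q, fun _ => (false, false, false))

/-- The summary of the infix of length `l` of the run on `w` that starts at position `m`. -/
noncomputable def block (w : ℕ → A) (m l : ℕ) : Q × (J → BlockTag) :=
  ((List.range l).map fun i => w (m + i)).foldl 𝒜.tagStep (tagInit (𝒜.state w m))

theorem block_zero (w : ℕ → A) (m : ℕ) : 𝒜.block w m 0 = tagInit (𝒜.state w m) := rfl

theorem block_succ (w : ℕ → A) (m l : ℕ) :
    𝒜.block w m (l + 1) = 𝒜.tagStep (𝒜.block w m l) (w (m + l)) := by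
  simp [block, List.range_succ]

theorem block_fst (w : ℕ → A) (m l : ℕ) : (𝒜.block w m l).1 = 𝒜.state w (m + l) := by
  induction l with
  | zero => rfl
  | succ l ih =>
    rw [block_succ, ← Nat.add_assoc, state, ← ih]
    rfl

theorem block_resp (w : ℕ → A) (m l : ℕ) (j : J) :
    ((𝒜.block w m l).2 j).resp ↔ ∃ i, m ≤ i ∧ i < m + l ∧ 𝒜.state w i ∈ 𝒜.response j := by
  induction l with
  | zero =>
    simp only [block_zero, tagInit, BlockTag.resp, Bool.false_eq_true, false_iff]
    rintro ⟨i, h1, h2, -⟩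
    omega
  | succ l ih =>
    rw [block_succ]
    simp only [tagStep, BlockTag.resp, decide_eq_true_eq] at ih ⊢
    rw [ih, block_fst]
    constructor
    · rintro (⟨i, h1, h2, h3⟩ | h)
      · exact ⟨i, h1, by omega, h3⟩
      · exact ⟨m + l, by omega, by omega, h⟩
    · rintro ⟨i, h1, h2, h3⟩
      by_cases h : i < m + l
      · exact Or.inl ⟨i, h1, h, h3⟩
      · obtain rfl : i = m + l := by omega
        exact Or.inr h3

theorem block_opn (w : ℕ → A) (m l : ℕ) (j : J) :
    ((𝒜.block w m l).2 j).opn ↔ ∃ i, m ≤ i ∧ i < m + l ∧ 𝒜.state w i ∈ 𝒜.request j ∧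
      ∀ i', i ≤ i' → i' < m + l → 𝒜.state w i' ∉ 𝒜.response j := by
  induction l with
  | zero =>
    simp only [block_zero, tagInit, BlockTag.opn, Bool.false_eq_true, false_iff]
    rintro ⟨i, h1, h2, -⟩
    omega
  | succ l ih =>
    rw [block_succ]
    simp only [tagStep, BlockTag.opn, decide_eq_true_eq] at ih ⊢
    rw [ih, block_fst]
    constructor
    · rintro ⟨⟨i, h1, h2, h3, h4⟩ | h, hr⟩
      · refine ⟨i, h1, by omega, h3, fun i' a b => ?_⟩
        by_cases h : i' < m + l
        · exact h4 i' a h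
        · obtain rfl : i' = m + l := by omega
          exact hr
      · refine ⟨m + l, by omega, by omega, h, fun i' a b => ?_⟩
        obtain rfl : i' = m + l := by omega
        exact hr
    · rintro ⟨i, h1, h2, h3, h4⟩
      refine ⟨?_, h4 _ (by omega) (by omega)⟩
      by_cases h : i < m + l
      · exact Or.inl ⟨i, h1, h, h3, fun i' a b => h4 i' a (by omega)⟩
      · obtain rfl : i = m + l := by omega
        exact Or.inr h3

theorem block_inc (w : ℕ → A) (m l : ℕ) (j : J) :
    ((𝒜.block w m l).2 j).inc ↔
      ∃ i, m ≤ i ∧ i < m + l ∧ 𝒜.cst j (𝒜.state w i) (w i) = TransitionCost.inc := by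
  induction l with
  | zero =>
    simp only [block_zero, tagInit, BlockTag.inc, Bool.false_eq_true, false_iff]
    rintro ⟨i, h1, h2, -⟩
    omega
  | succ l ih =>
    rw [block_succ]
    simp only [tagStep, BlockTag.inc, decide_eq_true_eq] at ih ⊢
    rw [ih, block_fst]
    constructor
    · rintro (⟨i, h1, h2, h3⟩ | h)
      · exact ⟨i, h1, by omega, h3⟩
      · exact ⟨m + l, by omega, by omega, h⟩
    · rintro ⟨i, h1, h2, h3⟩
      by_cases h : i < m + l
      · exact Or.inl ⟨i, h1, h, h3⟩
      · obtain rfl : i = m + l := by omega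
        exact Or.inr h3

theorem stCorPair_le_iff (w : ℕ → A) (j : J) (m b : ℕ) :
    𝒜.stCorPair j w m ≤ b ↔ (𝒜.state w m ∈ 𝒜.request j →
      ∃ m' ≥ m, 𝒜.state w m' ∈ 𝒜.response j ∧ 𝒜.infixCost j w m m' ≤ b) := by
  unfold stCorPair
  split_ifs with h
  · simp only [h, true_imp_iff]
    -- A strict bound on an infimum is witnessed by one of its terms, hence the passage from `≤ b`
    -- to `< b + 1`.
    rw [← ENat.lt_natCast_add_one_iff]
    simp only [iInf_lt_iff, Set.mem_ofPred_eq, exists_prop]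
    refine exists_congr fun m' => ?_
    rw [ENat.lt_natCast_add_one_iff, Nat.cast_le, and_assoc]
  · simp [h]

theorem mem_language_iff (w : ℕ → A) :
    w ∈ 𝒜.language ↔ ∃ b N : ℕ, ∀ j, ∀ m ≥ N, 𝒜.state w m ∈ 𝒜.request j →
      ∃ m' ≥ m, 𝒜.state w m' ∈ 𝒜.response j ∧ 𝒜.infixCost j w m m' ≤ b := by
  have hle : ∀ m b : ℕ, 𝒜.stCor w m ≤ b ↔ ∀ j, 𝒜.state w m ∈ 𝒜.request j →
      ∃ m' ≥ m, 𝒜.state w m' ∈ 𝒜.response j ∧ 𝒜.infixCost j w m m' ≤ b := by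
    intro m b
    rw [stCor, iSup_le_iff]
    exact forall_congr' fun j => 𝒜.stCorPair_le_iff w j m b
  constructor
  · intro h
    have h : limsup (𝒜.stCor w) atTop < ⊤ := h
    obtain ⟨b, hb⟩ := ENat.ne_top_iff_exists.1 h.ne
    have h2 : ∀ᶠ m in atTop, 𝒜.stCor w m < (b + 1 : ℕ) :=
      eventually_lt_of_limsup_lt (by rw [← hb]; exact_mod_cast Nat.lt_succ_self b)
    obtain ⟨N, hN⟩ := eventually_atTop.1 h2
    exact ⟨b + 1, N, fun j m hm => (hle m (b + 1)).1 (hN m hm).le j⟩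
  · rintro ⟨b, N, h⟩
    refine lt_of_le_of_lt (b := (b : ℕ∞)) ?_ (ENat.natCast_lt_top b)
    refine limsup_le_of_le (by isBoundedDefault) ?_
    filter_upwards [eventually_ge_atTop N] with m hm
    exact (hle m b).2 fun j => h j m hm

theorem exists_block_index {p : ℕ → ℕ} (hp : StrictMono p) (h0 : p 0 = 0) (m : ℕ) :
    ∃ t, p t ≤ m ∧ m < p (t + 1) := by
  induction m with
  | zero => exact ⟨0, h0.le, by have := hp (show 0 < 0 + 1 by omega); omega⟩
  | succ m ih =>
    obtain ⟨t, h1, h2⟩ := ih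
    by_cases h : m + 1 < p (t + 1)
    · exact ⟨t, by omega, h⟩
    · exact ⟨t + 1, by omega, by have := hp (show t + 1 < t + 1 + 1 by omega); omega⟩

variable {𝒜}

section Blocks

variable {w : ℕ → A} {p : ℕ → ℕ} (hp : StrictMono p) {D : ℕ → J → BlockTag}
  (hD : ∀ t, D t = (𝒜.block w (p t) (p (t + 1) - p t)).2)

include hp hD

theorem tag_resp_iff (t : ℕ) (j : J) :
    (D t j).resp ↔ ∃ i, p t ≤ i ∧ i < p (t + 1) ∧ 𝒜.state w i ∈ 𝒜.response j := by
  rw [hD, block_resp, Nat.add_sub_cancel' (hp (Nat.lt_succ_self t)).le]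

theorem tag_opn_iff (t : ℕ) (j : J) :
    (D t j).opn ↔ ∃ i, p t ≤ i ∧ i < p (t + 1) ∧ 𝒜.state w i ∈ 𝒜.request j ∧
      ∀ i', i ≤ i' → i' < p (t + 1) → 𝒜.state w i' ∉ 𝒜.response j := by
  rw [hD, block_opn, Nat.add_sub_cancel' (hp (Nat.lt_succ_self t)).le]

theorem tag_inc_iff (t : ℕ) (j : J) :
    (D t j).inc ↔ ∃ i, p t ≤ i ∧ i < p (t + 1) ∧
      𝒜.cst j (𝒜.state w i) (w i) = TransitionCost.inc := by
  rw [hD, block_inc, Nat.add_sub_cancel' (hp (Nat.lt_succ_self t)).le]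

/-- Each counted block lies entirely between request and response and contributes its own increment.
Block lengths play no role, which leaves Player I free to use blocks of any length. -/
theorem good_of_mem_language (h0 : p 0 = 0) (hw : w ∈ 𝒜.language) : Good D := by
  obtain ⟨b, N, h⟩ := (𝒜.mem_language_iff w).1 hw
  refine ⟨b, N, fun j t ht ho => ?_⟩
  obtain ⟨i, h1, h2, h3, h4⟩ := (tag_opn_iff hp hD t j).1 ho
  obtain ⟨m', hm', hr, hc⟩ := h j i ((ht.trans hp.le_apply).trans h1) h3
  obtain ⟨t', h5, h6⟩ := exists_block_index hp h0 m'
  have h7 : p (t + 1) ≤ m' := by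
    by_contra h8
    exact h4 m' hm' (by omega) hr
  have h8 : t + 1 < t' + 1 := hp.lt_iff_lt.1 (h7.trans_lt h6)
  refine ⟨t', by omega, (tag_resp_iff hp hD t' j).2 ⟨m', h5, h6, hr⟩, le_trans ?_ hc⟩
  have hex : ∀ s, ∃ i, (D s j).inc → p s ≤ i ∧ i < p (s + 1) ∧
      𝒜.cst j (𝒜.state w i) (w i) = TransitionCost.inc := by
    intro s
    by_cases hs : (D s j).inc
    · obtain ⟨i, hi⟩ := (tag_inc_iff hp hD s j).1 hs
      exact ⟨i, fun _ => hi⟩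
    · exact ⟨0, fun h => absurd h hs⟩
  choose g hg using hex
  refine Finset.card_le_card_of_injOn g ?_ ?_
  · intro s hs
    obtain ⟨hs1, hs2⟩ := Finset.mem_filter.1 hs
    rw [Finset.mem_Ico] at hs1
    obtain ⟨a1, a2, a3⟩ := hg s hs2
    have b1 := hp.monotone hs1.1
    have b2 := hp.monotone (Nat.succ_le_of_lt hs1.2)
    refine Finset.mem_filter.2 ⟨Finset.mem_Ico.2 ⟨by omega, ?_⟩, a3⟩
    exact lt_of_lt_of_le a2 (b2.trans h5)
  · have key : ∀ s s', (D s j).inc → (D s' j).inc → s < s' → g s < g s' := by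
      intro s s' hs hs' hlt
      exact (hg s hs).2.1.trans_le ((hp.monotone (Nat.succ_le_of_lt hlt)).trans (hg s' hs').1)
    intro s hs s' hs' heq
    have c1 := (Finset.mem_filter.1 hs).2
    have c2 := (Finset.mem_filter.1 hs').2
    rcases lt_trichotomy s s' with hlt | rfl | hlt
    · exact absurd heq (key _ _ c1 c2 hlt).ne
    · rfl
    · exact absurd heq (key _ _ c2 c1 hlt).ne'

/-- All increments before the answer lie in the block of the request, the block of the response, or
one of at most `b` blocks in between; each holds at most `d`. -/
theorem mem_language_of_good (h0 : p 0 = 0) {d : ℕ} (hd : ∀ t, p (t + 1) - p t ≤ d)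
    (hg : Good D) : w ∈ 𝒜.language := by
  classical
  obtain ⟨b, N, h⟩ := hg
  refine (𝒜.mem_language_iff w).2 ⟨(b + 2) * d, p N, fun j m hm hreq => ?_⟩
  obtain ⟨t, h1, h2⟩ := exists_block_index hp h0 m
  have htN : N ≤ t := by
    have : p N < p (t + 1) := hm.trans_lt h2
    have := hp.lt_iff_lt.1 this
    omega
  by_cases hans : ∃ m', m ≤ m' ∧ m' < p (t + 1) ∧ 𝒜.state w m' ∈ 𝒜.response j
  · obtain ⟨m', a1, a2, a3⟩ := hans
    refine ⟨m', a1, a3, ?_⟩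
    have c1 : 𝒜.infixCost j w m m' ≤ m' - m := by
      rw [← Nat.card_Ico]
      exact Finset.card_filter_le _ _
    have := hd t
    nlinarith [Nat.zero_le (b * d), (by omega : m' - m ≤ d)]
  · push Not at hans
    obtain ⟨t', ht', hr, hc⟩ := h j t htN ((tag_opn_iff hp hD t j).2 ⟨m, h1, h2, hreq, hans⟩)
    obtain ⟨m', a1, a2, a3⟩ := (tag_resp_iff hp hD t' j).1 hr
    have hpm := hp.monotone (Nat.succ_le_of_lt ht')
    refine ⟨m', by simp only [Nat.succ_eq_add_one] at hpm; omega, a3, ?_⟩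
    set S : Finset ℕ := insert t (insert t'
      ((Finset.Ico (t + 1) t').filter fun u => (D u j).inc)) with hS
    have hScard : S.card ≤ b + 2 := by
      refine (Finset.card_insert_le _ _).trans ?_
      have := Finset.card_insert_le t' ((Finset.Ico (t + 1) t').filter fun u => (D u j).inc)
      have hc' : ((Finset.Ico (t + 1) t').filter fun u => (D u j).inc).card ≤ b := hc
      omega
    have hsub : ((Finset.Ico m m').filter fun i =>
        𝒜.cst j (𝒜.state w i) (w i) = TransitionCost.inc) ⊆
        S.biUnion fun s => Finset.Ico (p s) (p (s + 1)) := by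
      intro i hi
      obtain ⟨hi1, hi2⟩ := Finset.mem_filter.1 hi
      rw [Finset.mem_Ico] at hi1
      obtain ⟨s, b1, b2⟩ := exists_block_index hp h0 i
      refine Finset.mem_biUnion.2 ⟨s, ?_, Finset.mem_Ico.2 ⟨b1, b2⟩⟩
      have hs1 : t < s + 1 := hp.lt_iff_lt.1 (by omega)
      have hs2 : s < t' + 1 := hp.lt_iff_lt.1 (by omega)
      simp only [hS, Finset.mem_insert, Finset.mem_filter, Finset.mem_Ico]
      by_cases e1 : s = t
      · exact Or.inl e1
      by_cases e2 : s = t'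
      · exact Or.inr (Or.inl e2)
      exact Or.inr (Or.inr ⟨⟨by omega, by omega⟩, (tag_inc_iff hp hD s j).2 ⟨i, b1, b2, hi2⟩⟩)
    calc 𝒜.infixCost j w m m' ≤ (S.biUnion fun s => Finset.Ico (p s) (p (s + 1))).card :=
          Finset.card_le_card hsub
      _ ≤ S.card * d := Finset.card_biUnion_le_card_mul _ _ _ fun s _ => by
          rw [Nat.card_Ico]; exact hd s
      _ ≤ (b + 2) * d := Nat.mul_le_mul_right d hScard

end Blocks

/-! ### Classes of input words and pumping. -/

section Reach

variable {X Y : Type*} (𝒜 : StreettAutomaton Q (X × Y) J)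

/-- The states, with summaries, that are reachable from `q` by reading words whose first component
is `x`. -/
def reach (x : List X) (q : Q) : Set (Q × (J → BlockTag)) :=
  {r | ∃ y : List Y, y.length = x.length ∧ r = (x.zip y).foldl 𝒜.tagStep (tagInit q)}

theorem reach_append (x z : List X) (q : Q) :
    𝒜.reach (x ++ z) q = {r | ∃ r₀ ∈ 𝒜.reach x q, ∃ y : List Y, y.length = z.length ∧
      r = (z.zip y).foldl 𝒜.tagStep r₀} := by
  ext r
  constructor
  · rintro ⟨y, hy, rfl⟩
    rw [List.length_append] at hy
    refine ⟨_, ⟨y.take x.length, by simp; omega, rfl⟩, y.drop x.length, by simp; omega, ?_⟩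
    rw [← List.foldl_append, ← List.zip_append (by simp; omega), List.take_append_drop]
  · rintro ⟨_, ⟨y, hy, rfl⟩, y', hy', rfl⟩
    exact ⟨y ++ y', by simp [hy, hy'], by
      rw [List.zip_append hy.symm, List.foldl_append]⟩

theorem reach_append_congr {x x' : List X} (h : 𝒜.reach x = 𝒜.reach x') (z : List X) :
    𝒜.reach (x ++ z) = 𝒜.reach (x' ++ z) := by
  funext q
  rw [reach_append, reach_append, h]

/-- The relations that are induced by words of unbounded length. -/
def InfClass : Type _ :=
  {r : Q → Set (Q × (J → BlockTag)) // ∀ N, ∃ x : List X, N ≤ x.length ∧ 𝒜.reach x = r}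

/-- There are more prefixes of `x` than relations, so two prefixes induce the same one. Repeating
the infix between them keeps the relation, as it is compatible with appending on the right. -/
theorem exists_longer [Fintype Q] [Fintype J] {x : List X}
    (hx : 2 ^ (Fintype.card Q ^ 2 * 2 ^ (3 * Fintype.card J)) ≤ x.length) :
    ∃ x' : List X, x.length < x'.length ∧ 𝒜.reach x' = 𝒜.reach x := by
  classical
  have hcard : Fintype.card (Q → Set (Q × (J → BlockTag))) =
      2 ^ (Fintype.card Q ^ 2 * 2 ^ (3 * Fintype.card J)) := by
    simp only [Fintype.card_fun, Fintype.card_set, Fintype.card_prod, Fintype.card_bool,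
      BlockTag]
    rw [← pow_mul]
    congr 1
    rw [pow_mul]
    norm_num
    ring
  obtain ⟨i, i', hne, heq⟩ := Fintype.exists_ne_map_eq_of_card_lt
    (fun i : Fin (x.length + 1) => 𝒜.reach (x.take i)) (by
      rw [hcard, Fintype.card_fin]; omega)
  wlog hlt : i < i' generalizing i i'
  · exact this i' i hne.symm heq.symm (lt_of_le_of_ne (not_lt.1 hlt) hne.symm)
  refine ⟨x.take i' ++ x.drop i, ?_, ?_⟩
  · have := i'.2
    have hlt' : (i : ℕ) < i' := hlt
    simp only [List.length_append, List.length_take, List.length_drop]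
    omega
  · rw [𝒜.reach_append_congr heq.symm, List.take_append_drop]

theorem exists_long_of_le_length [Fintype Q] [Fintype J] {x : List X}
    (hx : 2 ^ (Fintype.card Q ^ 2 * 2 ^ (3 * Fintype.card J)) ≤ x.length) (N : ℕ) :
    ∃ x' : List X, N ≤ x'.length ∧ 𝒜.reach x' = 𝒜.reach x := by
  induction N with
  | zero => exact ⟨x, Nat.zero_le _, rfl⟩
  | succ N ih =>
    obtain ⟨x', h1, h2⟩ := ih
    by_cases h : N < x'.length
    · exact ⟨x', h, h2⟩
    by_cases h3 : x.length ≤ x'.length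
    · obtain ⟨x'', h4, h5⟩ := 𝒜.exists_longer (hx.trans h3)
      exact ⟨x'', by omega, h5.trans h2⟩
    · exact ⟨x, by omega, rfl⟩

end Reach

end StreettAutomaton

/-! ### Strategies in delay games as causal maps on infinite words. -/

namespace DelayGame

open StreettGame

variable {X Y : Type*} {f : DelayFunction} {L : Set (ℕ → X × Y)}

/-- The number of input letters picked before round `i`. -/
def delaySum (f : DelayFunction) (i : ℕ) : ℕ := ∑ j ∈ Finset.range i, (f j : ℕ)

theorem delaySum_succ (f : DelayFunction) (i : ℕ) :
    delaySum f (i + 1) = delaySum f i + f i := Finset.sum_range_succ _ _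

theorem delaySum_mono (f : DelayFunction) : Monotone (delaySum f) :=
  monotone_nat_of_le_succ fun i => by rw [delaySum_succ]; omega

theorem delaySum_of_isConstant (hf : f.IsConstant) (i : ℕ) :
    delaySum f (i + 1) = (f 0 : ℕ) + i := by
  induction i with
  | zero => simp [delaySum]
  | succ i ih =>
    rw [delaySum_succ, ih, hf (i + 1) (Nat.succ_pos i)]
    simp [Nat.add_assoc]

namespace Play

theorem inputPrefix_succ (P : Play X Y f) (i : ℕ) :
    P.inputPrefix (i + 1) = P.inputPrefix i ++ P.u i := by
  simp [inputPrefix, List.range_succ, List.flatMap_append]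

theorem length_inputPrefix (P : Play X Y f) (i : ℕ) :
    (P.inputPrefix i).length = delaySum f i := by
  induction i with
  | zero => rfl
  | succ i ih => rw [inputPrefix_succ, List.length_append, ih, P.length_u, delaySum_succ]

theorem inputPrefix_prefix (P : Play X Y f) {i i' : ℕ} (h : i ≤ i') :
    P.inputPrefix i <+: P.inputPrefix i' := by
  induction i', h using Nat.le_induction with
  | base => exact List.prefix_rfl
  | succ i' _ ih =>
    rw [inputPrefix_succ]
    exact ih.trans (List.prefix_append _ _)

theorem inputPrefix_getElem (P : Play X Y f) (i m : ℕ) (h : m < (P.inputPrefix i).length) :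
    (P.inputPrefix i)[m] = P.input m := by
  unfold input
  rcases le_total i (m + 1) with h' | h'
  · exact (P.inputPrefix_prefix h').getElem h
  · exact ((P.inputPrefix_prefix h').getElem (P.le_length_inputPrefix (m + 1))).symm

theorem outputPrefix_getElem (P : Play X Y f) (i m : ℕ) (h : m < (P.outputPrefix i).length) :
    (P.outputPrefix i)[m] = P.v m := by
  simp [outputPrefix]

theorem length_outputPrefix (P : Play X Y f) (i : ℕ) : (P.outputPrefix i).length = i := by
  simp [outputPrefix]

end Play

/-- A map from output words to losing input words induces a winning strategy for Player I, if the
input letters that are picked in a round depend only on the previous output letters. -/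
theorem playerIWins_of_causal [Nonempty Y] (Φ : (ℕ → Y) → ℕ → X)
    (hΦ : ∀ v v' i, (∀ m < i, v m = v' m) → ∀ m < delaySum f (i + 1), Φ v m = Φ v' m)
    (hL : ∀ v, (fun m => (Φ v m, v m)) ∉ L) : PlayerIWins f L := by
  let ext : List Y → ℕ → Y := fun w m => w.getD m (Classical.arbitrary Y)
  refine ⟨⟨fun w => (List.range (f w.length)).map fun k => Φ (ext w) (delaySum f w.length + k),
    fun w => by simp⟩, fun P hP => ?_⟩
  have hext : ∀ i, ∀ m < i, ext (P.outputPrefix i) m = P.v m := by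
    intro i m hm
    have hm' : m < (P.outputPrefix i).length := by rwa [P.length_outputPrefix]
    simp only [ext, List.getD_eq_getElem _ _ hm', P.outputPrefix_getElem]
  have hpre : ∀ i, P.inputPrefix i = (List.range (delaySum f i)).map (Φ P.v) := by
    intro i
    induction i with
    | zero => rfl
    | succ i ih =>
      rw [P.inputPrefix_succ, ih, hP i, delaySum_succ, List.range_add, List.map_append,
        List.map_map]
      congr 1
      simp only [P.length_outputPrefix]
      refine List.map_congr_left fun k hk => ?_
      refine hΦ _ _ i (hext i) _ ?_
      rw [delaySum_succ]
      have := List.mem_range.1 hk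
      omega
  have hin : ∀ m, P.input m = Φ P.v m := by
    intro m
    simp [Play.input, hpre]
  have : P.outcome = fun m => (Φ P.v m, P.v m) := by
    funext m
    rw [Play.outcome, hin]
  rw [this]
  exact hL P.v

/-- A map from input words to winning output words induces a winning strategy for Player O in a
game with constant delay, if each output letter depends only on the input letters up to the
lookahead. -/
theorem playerOWins_of_causal [Nonempty X] (hf : f.IsConstant) (Ψ : (ℕ → X) → ℕ → Y)
    (hΨ : ∀ u u' i, (∀ m < (f 0 : ℕ) + i, u m = u' m) → Ψ u i = Ψ u' i)
    (hL : ∀ u, (fun m => (u m, Ψ u m)) ∈ L) : PlayerOWins f L := by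
  let ext : List X → ℕ → X := fun w m => w.getD m (Classical.arbitrary X)
  -- In round `i` exactly `f 0 + i` input letters are known, so the length of `w` reveals the round.
  refine ⟨fun w => Ψ (ext w) (w.length - (f 0 : ℕ)), fun P hP => ?_⟩
  have : P.outcome = fun m => (P.input m, Ψ P.input m) := by
    funext m
    rw [Play.outcome, hP m]
    have hlen : (P.inputPrefix (m + 1)).length = (f 0 : ℕ) + m := by
      rw [P.length_inputPrefix, delaySum_of_isConstant hf]
    congr 1
    beta_reduce
    rw [hlen, Nat.add_sub_cancel_left]
    refine hΨ _ _ m fun i hi => ?_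
    have hi' : i < (P.inputPrefix (m + 1)).length := by rwa [hlen]
    simp only [ext, List.getD_eq_getElem _ _ hi', P.inputPrefix_getElem]
  rw [this]
  exact hL P.input

/-- The words `u₀ ⋯ u_{i-1}` and `v₀ ⋯ v_{i-1}` of the play between two strategies. -/
def versus (τ : StrategyI X Y f) (σ : StrategyO X Y) : ℕ → List X × List Y
  | 0 => ([], [])
  | i + 1 =>
    let c := versus τ σ i
    (c.1 ++ τ.move c.2, c.2 ++ [σ (c.1 ++ τ.move c.2)])

/-- Playing two winning strategies against each other would give a play won by both players. -/
theorem not_playerIWins_of_playerOWins (hO : PlayerOWins f L) : ¬ PlayerIWins f L := by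
  rintro ⟨τ, hτ⟩
  obtain ⟨σ, hσ⟩ := hO
  have hlen : ∀ i, (versus τ σ i).2.length = i := by
    intro i
    induction i with
    | zero => rfl
    | succ i ih => simp [versus, ih]
  let P : Play X Y f :=
    { u := fun i => τ.move (versus τ σ i).2
      length_u := fun i => by rw [τ.length_move, hlen]
      v := fun i => σ ((versus τ σ i).1 ++ τ.move (versus τ σ i).2) }
  have h1 : ∀ i, P.inputPrefix i = (versus τ σ i).1 := by
    intro i
    induction i with
    | zero => rfl
    | succ i ih => rw [P.inputPrefix_succ, ih]; rfl
  have h2 : ∀ i, P.outputPrefix i = (versus τ σ i).2 := by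
    intro i
    induction i with
    | zero => rfl
    | succ i ih =>
      have : P.outputPrefix (i + 1) = P.outputPrefix i ++ [P.v i] := by
        simp [Play.outputPrefix, List.range_succ]
      rw [this, ih]
      rfl
  refine hτ P (fun i => by rw [h2]) (hσ P fun i => ?_)
  rw [h1]
  rfl

end DelayGame

/-! ### The game on classes of words. -/

namespace StreettAutomaton

open StreettGame CostGame DelayGame

variable {Q J X Y : Type*} (𝒜 : StreettAutomaton Q (X × Y) J)

instance [Finite Q] [Finite J] : Finite 𝒜.InfClass :=
  inferInstanceAs (Finite {r : Q → Set (Q × (J → BlockTag)) //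
    ∀ N, ∃ x : List X, N ≤ x.length ∧ 𝒜.reach x = r})

theorem InfClass.nonempty [Nonempty Y] (r : 𝒜.InfClass) (q : Q) : (r.1 q).Nonempty := by
  obtain ⟨x, -, hx⟩ := r.2 0
  rw [← hx]
  exact ⟨_, List.replicate x.length (Classical.arbitrary Y), by simp, rfl⟩

/-- The reply `b` of Player O in the game on classes of words, corrected if it is not realized by
the class. -/
noncomputable def classReply [Nonempty Y] (v : Q × 𝒜.InfClass) (b : Q × (J → BlockTag)) :
    Q × (J → BlockTag) :=
  open Classical in if b ∈ v.2.1 v.1 then b else (InfClass.nonempty 𝒜 v.2 v.1).some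

variable {𝒜} in
theorem classReply_mem [Nonempty Y] (v : Q × 𝒜.InfClass) (b : Q × (J → BlockTag)) :
    𝒜.classReply v b ∈ v.2.1 v.1 := by
  unfold classReply
  split_ifs with h
  · exact h
  · exact Set.Nonempty.some_mem _

/-- The moves of the game on classes of words: the position consists of a state and the class of
the next block; Player I picks the class of the block after it, then Player O picks a run on the
next block. -/
noncomputable def classNext [Nonempty Y] (v : Q × 𝒜.InfClass) (a : 𝒜.InfClass)
    (b : Q × (J → BlockTag)) : Q × 𝒜.InfClass :=
  ((𝒜.classReply v b).1, a)

/-- The summary of the run on a block that is picked in the game on classes of words. -/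
noncomputable def classLab [Nonempty Y] (v : Q × 𝒜.InfClass) (_ : 𝒜.InfClass)
    (b : Q × (J → BlockTag)) : J → BlockTag :=
  (𝒜.classReply v b).2

/-! ### From the class game to Player I in delay games. -/

section PlayerI

variable (τ : List (Q × (J → BlockTag)) → 𝒜.InfClass) (wordOf : 𝒜.InfClass → ℕ → List X)
  (r₀ : 𝒜.InfClass) (F : ℕ → ℕ)

/-- A stage of the simulation of a strategy for the game on classes of words: the concatenation of
the previous blocks, the current block, the previous runs and the current state. -/
structure Stage where
  /-- the concatenation of the previous blocks -/
  pre : List X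
  /-- the current block -/
  word : List X
  /-- the previous runs, most recent first -/
  runs : List (Q × (J → BlockTag))
  /-- the current state -/
  cur : Q

/-- The run on the current block. -/
noncomputable def Stage.run (S : Stage (Q := Q) (J := J) (X := X)) (v : ℕ → Y) : Q × (J → BlockTag) :=
  (S.word.zip ((List.range S.word.length).map fun i => v (S.pre.length + i))).foldl 𝒜.tagStep
    (tagInit S.cur)

/-- The stages of the simulation of the strategy `τ` for Player I. -/
noncomputable def stage (v : ℕ → Y) : ℕ → Stage (Q := Q) (J := J) (X := X)
  | 0 => ⟨[], wordOf r₀ 1, [], 𝒜.init⟩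
  | t + 1 =>
    let S := stage v t
    -- `S.runs` excludes the run on `S.word`: the new block is fixed before Player O answers the
    -- current one. Its length exceeds the input due by round `(S.pre ++ S.word).length`.
    ⟨S.pre ++ S.word, wordOf (τ S.runs) (F (S.pre ++ S.word).length + 1), S.run 𝒜 v :: S.runs,
      (S.run 𝒜 v).1⟩

/-- The input word that is produced by the simulation of the strategy `τ`. -/
noncomputable def stageInput [Nonempty X] (v : ℕ → Y) (m : ℕ) : X :=
  (𝒜.stage τ wordOf r₀ F v (m + 1)).pre.getD m (Classical.arbitrary X)

variable {τ wordOf r₀ F} (hlen : ∀ r N, N ≤ (wordOf r N).length)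

include hlen

theorem stage_word_pos (v : ℕ → Y) (t : ℕ) : 0 < (𝒜.stage τ wordOf r₀ F v t).word.length := by
  cases t with
  | zero => exact hlen _ _
  | succ t => exact (Nat.succ_pos _).trans_le (hlen _ _)

theorem strictMono_stage_pre (v : ℕ → Y) :
    StrictMono fun t => (𝒜.stage τ wordOf r₀ F v t).pre.length := by
  refine strictMono_nat_of_lt_succ fun t => ?_
  have := 𝒜.stage_word_pos (τ := τ) (r₀ := r₀) (F := F) hlen v t
  simp only [stage, List.length_append]
  omega

theorem stageInput_eq [Nonempty X] (v : ℕ → Y) {t m : ℕ}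
    (h : m < (𝒜.stage τ wordOf r₀ F v t).pre.length) :
    𝒜.stageInput τ wordOf r₀ F v m =
      (𝒜.stage τ wordOf r₀ F v t).pre.getD m (Classical.arbitrary X) := by
  have hpre : ∀ s t, s ≤ t →
      (𝒜.stage τ wordOf r₀ F v s).pre <+: (𝒜.stage τ wordOf r₀ F v t).pre := by
    intro s t hst
    induction t, hst using Nat.le_induction with
    | base => exact List.prefix_rfl
    | succ t _ ih => exact ih.trans (List.prefix_append _ _)
  have h' : m < (𝒜.stage τ wordOf r₀ F v (m + 1)).pre.length :=
    (Nat.lt_succ_self m).trans_le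
      (𝒜.strictMono_stage_pre (τ := τ) (r₀ := r₀) (F := F) hlen v).le_apply
  rw [stageInput, List.getD_eq_getElem _ _ h, List.getD_eq_getElem _ _ h']
  rcases le_total t (m + 1) with hle | hle
  · exact ((hpre _ _ hle).getElem h).symm
  · exact (hpre _ _ hle).getElem h'

/-- The block with index `s + 1` depends only on outputs before the start of block `s`. If that
start were beyond `i`, block `s` alone would be longer than `F i`, so position `m < F i` would not
lie in block `s + 1`. -/
theorem stageInput_causal [Nonempty X] (hF : Monotone F) {v v' : ℕ → Y} {i m : ℕ}
    (hv : ∀ m < i, v m = v' m) (hm : m < F i) :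
    𝒜.stageInput τ wordOf r₀ F v m = 𝒜.stageInput τ wordOf r₀ F v' m := by
  have hmono := 𝒜.strictMono_stage_pre (τ := τ) (r₀ := r₀) (F := F) hlen v
  have hst : ∀ t, (𝒜.stage τ wordOf r₀ F v t).pre.length ≤ i →
      𝒜.stage τ wordOf r₀ F v t = 𝒜.stage τ wordOf r₀ F v' t := by
    intro t
    induction t with
    | zero => exact fun _ => rfl
    | succ t ih =>
      intro h
      have e := ih ((hmono (Nat.lt_succ_self t)).le.trans h)
      have e2 : (𝒜.stage τ wordOf r₀ F v t).run 𝒜 v = (𝒜.stage τ wordOf r₀ F v t).run 𝒜 v' := by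
        unfold Stage.run
        congr 2
        refine List.map_congr_left fun k hk => hv _ ?_
        have hk := List.mem_range.1 hk
        simp only [stage, List.length_append] at h
        omega
      simp only [stage, ← e, ← e2]
  have hpre2 : ∀ t, (𝒜.stage τ wordOf r₀ F v t).pre.length ≤ i →
      (𝒜.stage τ wordOf r₀ F v (t + 2)).pre = (𝒜.stage τ wordOf r₀ F v' (t + 2)).pre := by
    intro t h
    simp only [stage, hst t h]
  obtain ⟨t, h1, h2⟩ := exists_block_index hmono rfl m
  obtain ⟨t', h3, h4⟩ : ∃ t', m < (𝒜.stage τ wordOf r₀ F v (t' + 2)).pre.length ∧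
      (𝒜.stage τ wordOf r₀ F v t').pre.length ≤ i := by
    rcases t with _ | s
    · exact ⟨0, h2.trans (hmono (show 0 + 1 < 0 + 2 by omega)), Nat.zero_le _⟩
    refine ⟨s, h2, ?_⟩
    by_contra! hcon
    rcases s with _ | u
    · simp [stage] at hcon
    · have a1 := hlen (τ (𝒜.stage τ wordOf r₀ F v u).runs)
        (F (𝒜.stage τ wordOf r₀ F v (u + 1)).pre.length + 1)
      have a2 := hF hcon.le
      have a3 : (𝒜.stage τ wordOf r₀ F v (u + 1 + 1)).pre.length =
        (𝒜.stage τ wordOf r₀ F v (u + 1)).pre.length +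
        (wordOf (τ (𝒜.stage τ wordOf r₀ F v u).runs)
          (F (𝒜.stage τ wordOf r₀ F v (u + 1)).pre.length + 1)).length := by
        rw [← List.length_append]
        rfl
      change (𝒜.stage τ wordOf r₀ F v (u + 1 + 1)).pre.length ≤ m at h1
      omega
  rw [𝒜.stageInput_eq hlen v h3, 𝒜.stageInput_eq hlen v' (by rw [← hpre2 _ h4]; exact h3),
    hpre2 _ h4]

theorem stage_zip [Nonempty X] (v : ℕ → Y) (t : ℕ) :
    (𝒜.stage τ wordOf r₀ F v t).word.zip ((List.range (𝒜.stage τ wordOf r₀ F v t).word.length).map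
        fun i => v ((𝒜.stage τ wordOf r₀ F v t).pre.length + i)) =
      (List.range (𝒜.stage τ wordOf r₀ F v t).word.length).map fun i =>
        (𝒜.stageInput τ wordOf r₀ F v ((𝒜.stage τ wordOf r₀ F v t).pre.length + i),
          v ((𝒜.stage τ wordOf r₀ F v t).pre.length + i)) := by
  refine List.ext_getElem (by simp) fun i h1 h2 => ?_
  have hi : i < (𝒜.stage τ wordOf r₀ F v t).word.length := by simpa using h2
  simp only [List.getElem_zip, List.getElem_map, List.getElem_range, Prod.mk.injEq, and_true]
  have h3 : (𝒜.stage τ wordOf r₀ F v t).pre.length + i <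
      (𝒜.stage τ wordOf r₀ F v (t + 1)).pre.length := by
    simp only [stage, List.length_append]
    omega
  rw [𝒜.stageInput_eq hlen v h3, List.getD_eq_getElem _ _ h3]
  simp [stage]

theorem stage_run [Nonempty X] (v : ℕ → Y) (t : ℕ) :
    (𝒜.stage τ wordOf r₀ F v t).run 𝒜 v =
      𝒜.block (fun m => (𝒜.stageInput τ wordOf r₀ F v m, v m))
        (𝒜.stage τ wordOf r₀ F v t).pre.length (𝒜.stage τ wordOf r₀ F v t).word.length := by
  have hcur : (𝒜.stage τ wordOf r₀ F v t).cur =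
      𝒜.state (fun m => (𝒜.stageInput τ wordOf r₀ F v m, v m))
        (𝒜.stage τ wordOf r₀ F v t).pre.length := by
    induction t with
    | zero => rfl
    | succ t ih =>
      have h1 : (𝒜.stage τ wordOf r₀ F v (t + 1)).cur =
        ((𝒜.stage τ wordOf r₀ F v t).run 𝒜 v).1 := rfl
      have h2 : (𝒜.stage τ wordOf r₀ F v (t + 1)).pre.length =
        (𝒜.stage τ wordOf r₀ F v t).pre.length + (𝒜.stage τ wordOf r₀ F v t).word.length :=
        List.length_append
      rw [h1, h2, ← block_fst, block, Stage.run, 𝒜.stage_zip hlen, ih]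
  rw [block, Stage.run, 𝒜.stage_zip hlen, hcur]

omit hlen

/-- A winning strategy for Player I in the game on classes of words yields winning strategies for
all delay functions. -/
theorem playerIWins_of_iWinsCost [Nonempty X] [Nonempty Y] {r₀ : 𝒜.InfClass}
    (h : IWinsCost 𝒜.classNext 𝒜.classLab (𝒜.init, r₀)) (f : DelayFunction) :
    PlayerIWins f 𝒜.language := by
  obtain ⟨τ, hτ⟩ := h
  choose wordOf hlen hreach using fun (r : 𝒜.InfClass) => r.2
  set F : ℕ → ℕ := fun i => delaySum f (i + 1) with hF
  have hFm : Monotone F := fun a b hab => delaySum_mono f (Nat.succ_le_succ hab)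
  refine playerIWins_of_causal (fun v => 𝒜.stageInput τ wordOf r₀ F v)
    (fun v v' i hv m hm => 𝒜.stageInput_causal hlen hFm hv hm) fun v hmem => ?_
  set S : ℕ → Stage := 𝒜.stage τ wordOf r₀ F v with hS
  let b : ℕ → Q × (J → BlockTag) := fun t => (S t).run 𝒜 v
  have hruns : ∀ t, (S t).runs = hist b t := by
    intro t
    induction t with
    | zero => rfl
    | succ t ih => rw [hist, ← ih]; rfl
  let x : ℕ → Q × 𝒜.InfClass := fun t => ((S t).cur, Nat.casesOn t r₀ fun s => τ (S s).runs)
  have hx : ∀ t, (x t).2.1 = 𝒜.reach (S t).word := by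
    rintro (_ | t)
    · exact (hreach _ _).symm
    · exact (hreach _ _).symm
  -- The replies fed to `τ` are actual runs on the chosen words, so they are never corrected.
  have hb : ∀ t, 𝒜.classReply (x t) (b t) = b t := by
    intro t
    have hmem : b t ∈ (x t).2.1 (x t).1 := by
      rw [hx]
      exact ⟨_, by simp, rfl⟩
    rw [classReply, if_pos hmem]
  refine hτ x b rfl ?_ ?_
  · intro t
    rw [← hruns, classNext, hb]
    rfl
  · refine good_of_mem_language (𝒜.strictMono_stage_pre (τ := τ) (r₀ := r₀) (F := F) hlen v)
      ?_ rfl hmem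
    intro t
    rw [classLab, hb]
    simp only [b, hS]
    rw [𝒜.stage_run hlen]
    have h2 : (𝒜.stage τ wordOf r₀ F v (t + 1)).pre.length =
      (𝒜.stage τ wordOf r₀ F v t).pre.length + (𝒜.stage τ wordOf r₀ F v t).word.length :=
      List.length_append
    rw [h2, Nat.add_sub_cancel_left]

end PlayerI

/-! ### From the class game to Player O with constant lookahead. -/

section PlayerO

/-- The block of length `d` with index `t` of an infinite word. -/
def wordBlock {Z : Type*} (d : ℕ) (u : ℕ → Z) (t : ℕ) : List Z :=
  (List.range d).map fun i => u (t * d + i)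

theorem wordBlock_congr {Z : Type*} {d : ℕ} {u u' : ℕ → Z} {N t : ℕ}
    (h : ∀ m < N, u m = u' m) (ht : (t + 1) * d ≤ N) : wordBlock d u t = wordBlock d u' t := by
  refine List.map_congr_left fun i hi => h _ ?_
  have := List.mem_range.1 hi
  rw [Nat.succ_mul] at ht
  omega

variable {d : ℕ} (cls : List X → 𝒜.InfClass)
  (σ : 𝒜.InfClass → List 𝒜.InfClass → Q × (J → BlockTag))

/-- The history of the moves of Player I in the game on classes of words when the input is `u`. -/
def classHist (d : ℕ) (u : ℕ → X) : ℕ → List 𝒜.InfClass :=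
  hist fun t => cls (wordBlock d u (t + 1))

/-- The play in the game on classes of words that is induced by the input `u` and strategies `σ`
for Player O. -/
noncomputable def classPlay [Nonempty Y] (d : ℕ) (u : ℕ → X) : ℕ → Q × 𝒜.InfClass
  | 0 => (𝒜.init, cls (wordBlock d u 0))
  | t + 1 => 𝒜.classNext (classPlay d u t) (cls (wordBlock d u (t + 1)))
      (σ (cls (wordBlock d u 0)) (𝒜.classHist cls d u (t + 1)))

/-- The run on the block with index `t` that is picked by the strategies `σ`. -/
noncomputable def classRun [Nonempty Y] (d : ℕ) (u : ℕ → X) (t : ℕ) : Q × (J → BlockTag) :=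
  𝒜.classReply (𝒜.classPlay cls σ d u t)
    (σ (cls (wordBlock d u 0)) (𝒜.classHist cls d u (t + 1)))

/-- The output letters that realize the runs picked by the strategies `σ`. -/
noncomputable def classOutput [Nonempty Y] (d : ℕ)
    (real : List X → Q → Q × (J → BlockTag) → List Y) (u : ℕ → X) (i : ℕ) : Y :=
  (real (wordBlock d u (i / d)) (𝒜.classPlay cls σ d u (i / d)).1
    (𝒜.classRun cls σ d u (i / d))).getD (i % d) (Classical.arbitrary Y)

theorem classPlay_snd [Nonempty Y] (u : ℕ → X) (t : ℕ) :
    (𝒜.classPlay cls σ d u t).2 = cls (wordBlock d u t) := by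
  cases t <;> rfl

/-- The run on block `i / d` is picked knowing blocks up to `i / d + 1`. They end at `(i / d + 2) *
d ≤ 2 * d + i`, so two blocks of lookahead suffice. -/
theorem classOutput_causal [Nonempty Y] (real : List X → Q → Q × (J → BlockTag) → List Y)
    {u u' : ℕ → X} {i : ℕ} (h : ∀ m < 2 * d + i, u m = u' m) :
    𝒜.classOutput cls σ d real u i = 𝒜.classOutput cls σ d real u' i := by
  have hblk : ∀ s ≤ i / d + 1, wordBlock d u s = wordBlock d u' s := by
    intro s hs
    refine wordBlock_congr h ?_
    calc (s + 1) * d ≤ (i / d + 2) * d := Nat.mul_le_mul_right d (by omega)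
      _ = 2 * d + i / d * d := by ring
      _ ≤ 2 * d + i := Nat.add_le_add_left (Nat.div_mul_le_self i d) _
  have hhist : ∀ s ≤ i / d + 1, 𝒜.classHist cls d u s = 𝒜.classHist cls d u' s := by
    intro s hs
    exact hist_congr fun s' hs' => by rw [hblk _ (by omega)]
  have hplay : ∀ s ≤ i / d, 𝒜.classPlay cls σ d u s = 𝒜.classPlay cls σ d u' s := by
    intro s
    induction s with
    | zero => intro _; simp only [classPlay, hblk 0 (Nat.zero_le _)]
    | succ s ih =>
      intro hs
      simp only [classPlay, ih (by omega), hblk 0 (Nat.zero_le _), hblk (s + 1) (by omega),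
        hhist (s + 1) (by omega)]
  simp only [classOutput, classRun, hplay _ le_rfl, hblk _ (Nat.le_succ _),
    hblk 0 (Nat.zero_le _), hhist _ le_rfl]

/-- Winning strategies for Player O in the game on classes of words yield one in the delay game
with constant lookahead of twice the length of a block. -/
theorem playerOWins_of_oWinsCost [Fintype Q] [Fintype J] [Nonempty X] [Nonempty Y]
    (h : ∀ r₀ : 𝒜.InfClass, OWinsCost 𝒜.classNext 𝒜.classLab (𝒜.init, r₀))
    (hd : 2 ^ (Fintype.card Q ^ 2 * 2 ^ (3 * Fintype.card J)) ≤ d)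
    {f : DelayFunction} (hf : f.IsConstant) (hf0 : (f 0 : ℕ) = 2 * d) :
    PlayerOWins f 𝒜.language := by
  classical
  choose σ hσ using h
  have hd0 : 0 < d := (Nat.two_pow_pos _).trans_le hd
  -- The class given to words shorter than `d` is arbitrary; only blocks of length `d` are
  -- classified below.
  have hcls : ∀ x : List X, ∃ r : 𝒜.InfClass, d ≤ x.length → r.1 = 𝒜.reach x := by
    intro x
    by_cases hx : d ≤ x.length
    · exact ⟨⟨𝒜.reach x, 𝒜.exists_long_of_le_length (hd.trans hx)⟩, fun _ => rfl⟩
    · refine ⟨⟨𝒜.reach (List.replicate d (Classical.arbitrary X)),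
        𝒜.exists_long_of_le_length (by simpa using hd)⟩, fun h => absurd h hx⟩
  choose cls hcls using hcls
  have hreal : ∀ (x : List X) (q : Q) (b : Q × (J → BlockTag)), ∃ y : List Y, b ∈ 𝒜.reach x q →
      y.length = x.length ∧ b = (x.zip y).foldl 𝒜.tagStep (tagInit q) := by
    intro x q b
    by_cases hb : b ∈ 𝒜.reach x q
    · obtain ⟨y, hy⟩ := hb
      exact ⟨y, fun _ => hy⟩
    · exact ⟨[], fun h => absurd h hb⟩
  choose real hreal using hreal
  refine playerOWins_of_causal hf (𝒜.classOutput cls σ d real)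
    (fun u u' i hu => 𝒜.classOutput_causal cls σ real (by rwa [hf0] at hu)) fun u => ?_
  set w : ℕ → X × Y := fun m => (u m, 𝒜.classOutput cls σ d real u m) with hw
  have hlenblk : ∀ t, (wordBlock d u t).length = d := fun t => by simp [wordBlock]
  have hmem : ∀ t, 𝒜.classRun cls σ d u t ∈
      𝒜.reach (wordBlock d u t) (𝒜.classPlay cls σ d u t).1 := by
    intro t
    have := classReply_mem (𝒜.classPlay cls σ d u t)
      (σ (cls (wordBlock d u 0)) (𝒜.classHist cls d u (t + 1)))
    rwa [classPlay_snd, hcls _ (hlenblk t).ge] at this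
  have hzip : ∀ t, (wordBlock d u t).zip (real (wordBlock d u t) (𝒜.classPlay cls σ d u t).1
      (𝒜.classRun cls σ d u t)) = (List.range d).map fun i => w (t * d + i) := by
    intro t
    have hl := (hreal _ _ _ (hmem t)).1
    rw [hlenblk] at hl
    refine List.ext_getElem (by simp [hl, hlenblk]) fun i h1 h2 => ?_
    have hi : i < d := by simpa using h2
    have e1 : (t * d + i) / d = t := by
      rw [Nat.mul_comm, Nat.mul_add_div hd0, Nat.div_eq_of_lt hi, Nat.add_zero]
    have e2 : (t * d + i) % d = i := by
      rw [Nat.mul_comm, Nat.mul_add_mod, Nat.mod_eq_of_lt hi]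
    simp only [List.getElem_zip, List.getElem_map, List.getElem_range, hw, classOutput, e1, e2]
    rw [List.getD_eq_getElem _ _ (by rw [hl]; exact hi)]
    simp [wordBlock]
  have hrun : ∀ t, (𝒜.classPlay cls σ d u t).1 = 𝒜.state w (t * d) ∧
      𝒜.classRun cls σ d u t = 𝒜.block w (t * d) d := by
    intro t
    have key : (𝒜.classPlay cls σ d u t).1 = 𝒜.state w (t * d) →
        𝒜.classRun cls σ d u t = 𝒜.block w (t * d) d := by
      intro hq
      rw [(hreal _ _ _ (hmem t)).2, hzip, hq]
      rfl
    induction t with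
    | zero =>
      have hq : (𝒜.classPlay cls σ d u 0).1 = 𝒜.state w (0 * d) := by rw [Nat.zero_mul]; rfl
      exact ⟨hq, key hq⟩
    | succ t ih =>
      have ih := (ih fun hq => by rw [(hreal _ _ _ (hmem t)).2, hzip, hq]; rfl).2
      have hq : (𝒜.classPlay cls σ d u (t + 1)).1 = 𝒜.state w ((t + 1) * d) := by
        rw [Nat.succ_mul, ← block_fst, ← ih]
        rfl
      exact ⟨hq, key hq⟩
  have hp : StrictMono fun t : ℕ => t * d := fun a b hab => Nat.mul_lt_mul_of_pos_right hab hd0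
  have hg := hσ (cls (wordBlock d u 0)) (𝒜.classPlay cls σ d u)
    (fun t => cls (wordBlock d u (t + 1))) rfl (fun t => rfl)
  have hsub : ∀ t, (t + 1) * d - t * d = d := fun t => by
    rw [Nat.succ_mul, Nat.add_sub_cancel_left]
  refine mem_language_of_good hp ?_ (Nat.zero_mul d) (d := d) (fun t => (hsub t).le) hg
  intro t
  simp only [hsub]
  rw [← (hrun t).2]
  rfl

end PlayerO

end StreettAutomaton

theorem mainTheorem10 {Q J X Y : Type*} [Fintype Q] [Fintype J]
    (𝒜 : StreettAutomaton Q (X × Y) J) (n k : ℕ)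
    (hn : Fintype.card Q = n) (hk : Fintype.card J = k)
    (L : Set (ℕ → X × Y)) (hL : L = 𝒜.language)
    (f : DelayFunction) (hf : f.IsConstant)
    (hf0 : (f 0 : ℕ) = 2 ^ (n ^ 4 * 2 ^ (3 * k) + 1)) :
    (DelayGame.PlayerIWins f L ↔ ∀ f' : DelayFunction, DelayGame.PlayerIWins f' L) ∧
      ((∃ f' : DelayFunction, DelayGame.PlayerOWins f' L) → DelayGame.PlayerOWins f L) := by
  subst hL
  -- Degenerate alphabets: in both cases there are no plays. Without input letters Player I has no
  -- strategy; without output letters Player O has none.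
  rcases isEmpty_or_nonempty X with hX | hX
  · have hPlay : ∀ f : DelayFunction, IsEmpty (DelayGame.Play X Y f) := fun f => ⟨fun P => by
      have h := P.length_u 0
      rw [Subsingleton.elim (P.u 0) []] at h
      exact (f 0).pos.ne h⟩
    refine ⟨⟨fun ⟨τ, _⟩ => ?_, fun h => h f⟩, fun ⟨_, τ, _⟩ => ⟨τ, fun P => (hPlay f).elim P⟩⟩
    have h := τ.length_move []
    rw [Subsingleton.elim (τ.move []) []] at h
    exact absurd h (f 0).pos.ne
  rcases isEmpty_or_nonempty Y with hY | hY
  · refine ⟨⟨fun _ f' => ⟨⟨fun w => List.replicate (f' w.length) (Classical.arbitrary X),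
      fun w => by simp⟩, fun P => hY.elim (P.v 0)⟩, fun h => h f⟩, fun ⟨_, τ, _⟩ => hY.elim (τ [])⟩
  -- Exponent `n ^ 2` would suffice; `n ^ 4` dominates it because the initial state gives `n ≥ 1`.
  have hd : 2 ^ (Fintype.card Q ^ 2 * 2 ^ (3 * Fintype.card J)) ≤ 2 ^ (n ^ 4 * 2 ^ (3 * k)) := by
    have hpos : 0 < Fintype.card Q := Fintype.card_pos_iff.2 ⟨𝒜.init⟩
    rw [← hn, ← hk]
    exact Nat.pow_le_pow_right two_pos
      (Nat.mul_le_mul_right _ (Nat.pow_le_pow_right hpos (by norm_num)))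
  have hA : Nonempty 𝒜.InfClass := ⟨⟨𝒜.reach (List.replicate _ (Classical.arbitrary X)),
    𝒜.exists_long_of_le_length (by rw [List.length_replicate])⟩⟩
  have hdet : DelayGame.PlayerOWins f 𝒜.language ∨ ∀ f' : DelayFunction, DelayGame.PlayerIWins f' 𝒜.language := by
    -- The class of the first block is Player I's choice: Player O must cope with all of them, while
    -- he needs only one good opening. The `+ 1` in the exponent of `f 0` accounts for two blocks.
    by_cases h : ∀ r₀ : 𝒜.InfClass, CostGame.OWinsCost 𝒜.classNext 𝒜.classLab (𝒜.init, r₀)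
    · exact Or.inl (𝒜.playerOWins_of_oWinsCost h hd hf (by rw [hf0, pow_succ]; ring))
    · push Not at h
      obtain ⟨r₀, hr₀⟩ := h
      exact Or.inr (𝒜.playerIWins_of_iWinsCost
        ((CostGame.determinacy _ _ _).resolve_left hr₀))
  refine ⟨⟨fun h => ?_, fun h => h f⟩, fun ⟨f', h⟩ => ?_⟩
  · exact hdet.resolve_left fun hO => DelayGame.not_playerIWins_of_playerOWins hO h
  · exact hdet.resolve_right fun hI => DelayGame.not_playerIWins_of_playerOWins h (hI f')
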